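/- Let $k$ be a commutative ring, $H$ a Hopf algebra over $k$ that is projective as a $k$-module and has bijective antipode, $A$ a right $H$-comodule algebra with coaction $\rho(a)=a_{[0]}\otimes a_{[1]}$, and $B=A^{\mathrm{co}H}=\{a\in A : \rho(a)=a\otimes 1\}$. Assume that $A$ is a faithfully flat $H$-Galois extension of $B$: $A$ is faithfully flat as a left $B$-module, and the map $\mathrm{can}\colon A\otimes_B A\to A\otimes H$, $\mathrm{can}(a\otimes_B a')=aa'_{[0]}\otimes a'_{[1]}$, is bijective. For $h\in H$ write $\mathrm{can}^{-1}(1\otimes h)=\sum_i l_i(h)\otimes_B r_i(h)$. Let $M$ be a right $B$-module. Give $P=M\otimes_B A$ the right $A$-action on the second factor and the coaction $\rho(m\otimes_B a)=(m\otimes_B a_{[0]})\otimes a_{[1]}$. Let $E=\mathrm{END}_A(P)$ be the algebra of rational right $A$-linear endomorphisms of $P$, that is, of those $f$ for which there is an element $f_{[0]}\otimes f_{[1]}\in \mathrm{End}_A(P)\otimes H$ with $\rho(f(p))=f_{[0]}(p_{[0]})\otimes f_{[1]}p_{[1]}$ for all $p\in P$; then $f\mapsto f_{[0]}\otimes f_{[1]}$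 is the $H$-coaction on $E$. Let $\Omega_E$ be the set of right $H$-colinear algebra maps $t\colon H\to E$, with $t_1\sim t_2$ if and only if there is a unit $u$ of $E^{\mathrm{co}H}$ such that $u\,t_1(h)=t_2(h)\,u$ for all $h\in H$. Put $\overline{\Omega}_E=\Omega_E/\!\sim$. Let $\Lambda_M$ be the set of right $B$-linear maps $\phi\colon M\otimes_B A\to M$ for which $m\cdot a=\phi(m\otimes_B a)$ is a (unital, associative) right $A$-module structure on $M$, with $\phi_1\sim\phi_2$ if and only if the two resulting right $A$-modules are isomorphic. Put $\overline{\Lambda}_M=\Lambda_M/\!\sim$. Then the formula $$\hat\alpha(\phi)(h)(m\otimes_B a)=\sum_i \phi(m\otimes_B l_i(h))\otimes_B r_i(h)a$$ defines a bijection $\hat\alpha\colon\Lambda_M\to\Omega_E$, and for all $\phi_1,\phi_2\in\Lambda_M$ with $t_j=\hat\alpha(\phi_j)$: $$\phi_1\sim\phi_2\iff t_1\sim t_2.$$ Moreover, for $t_1,t_2\in\Omega_E$, $t_1\sim t_2$ if and only if there is a unit $f$ of $\mathrm{End}_B(M)$ with $(f\otimes_B A)\circ t_1(h)=t_2(h)\circ(f\otimes_B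 A)$ for all $h\in H$. Consequently $\hat\alpha$ induces a bijection $\overline{\Lambda}_M\cong\overline{\Omega}_E$, and $\overline{\Omega}_E$ classifies the isomorphism classes of right $A$-module structures on $M$ extending the right $B$-action: sending the class of $\hat\alpha(\phi)$ to the class of the right $A$-module $(M,\phi)$ is a well-defined bijection from $\overline{\Omega}_E$ to the set of these isomorphism classes. -/

import Mathlib

open TensorProduct MulOpposite

universe uk uH uA uM

noncomputable section

namespace HopfGalois

universe w

/-! ### The tensor product over a noncommutative algebra

A right module over a ring `R` is a module over `Rᵐᵒᵖ`, so `m * r` is written `op r • m`. -/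

section BalancedTensor

variable (k : Type*) [CommRing k] (B : Type*) [Ring B]
variable (M : Type*) [AddCommGroup M] [Module k M] [Module Bᵐᵒᵖ M]
variable (N : Type*) [AddCommGroup N] [Module k N] [Module B N]

/-- The submodule of `M ⊗[k] N` generated by the elements `m b ⊗ n - m ⊗ b n`. -/
def balancedRelations : Submodule k (M ⊗[k] N) :=
  Submodule.span k {x | ∃ (m : M) (b : B) (n : N), x = (op b • m) ⊗ₜ[k] n - m ⊗ₜ[k] (b • n)}

/-- The tensor product `M ⊗_B N` of a right `B`-module `M` and a left `B`-module `N` over a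
`k`-algebra `B`. -/
def BTensor : Type _ := (M ⊗[k] N) ⧸ balancedRelations k B M N

instance : AddCommGroup (BTensor k B M N) :=
  inferInstanceAs (AddCommGroup ((M ⊗[k] N) ⧸ balancedRelations k B M N))

instance : Module k (BTensor k B M N) :=
  inferInstanceAs (Module k ((M ⊗[k] N) ⧸ balancedRelations k B M N))

/-- The projection `M ⊗[k] N → M ⊗_B N`. -/
def BTensor.proj : M ⊗[k] N →ₗ[k] BTensor k B M N := (balancedRelations k B M N).mkQ

variable {M N}

/-- The element `m ⊗_B n`. -/
def BTensor.tmul (m : M) (n : N) : BTensor k B M N := BTensor.proj k B M N (m ⊗ₜ[k] n)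

variable {k B}

theorem BTensor.smul_tmul (m : M) (b : B) (n : N) :
    BTensor.tmul k B (op b • m) n = BTensor.tmul k B m (b • n) :=
  (Submodule.Quotient.eq _).2 (Submodule.subset_span ⟨m, b, n, rfl⟩)

theorem BTensor.tmul_add (m : M) (n n' : N) :
    BTensor.tmul k B m (n + n') = BTensor.tmul k B m n + BTensor.tmul k B m n' := by
  simp [BTensor.tmul, TensorProduct.tmul_add]

/-- `k`-linear maps out of `M ⊗_B N` that agree on the elements `m ⊗_B n` are equal. -/
theorem BTensor.hom_ext {Q : Type*} [AddCommGroup Q] [Module k Q]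
    {f g : BTensor k B M N →ₗ[k] Q}
    (h : ∀ m n, f (BTensor.tmul k B m n) = g (BTensor.tmul k B m n)) : f = g :=
  Submodule.linearMap_qext _ (TensorProduct.ext' h)

/-- The universal property of `M ⊗_B N`: a `k`-bilinear `B`-balanced map `f` induces the `k`-linear
map `m ⊗_B n ↦ f m n`. -/
def BTensor.lift {Q : Type*} [AddCommGroup Q] [Module k Q] (f : M →ₗ[k] N →ₗ[k] Q)
    (hf : ∀ (m : M) (b : B) (n : N), f (op b • m) n = f m (b • n)) :
    BTensor k B M N →ₗ[k] Q :=
  (balancedRelations k B M N).liftQ (TensorProduct.lift f) <| by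
    refine Submodule.span_le.2 ?_
    rintro _ ⟨m, b, n, rfl⟩
    simp [hf]

@[simp]
theorem BTensor.lift_tmul {Q : Type*} [AddCommGroup Q] [Module k Q] (f : M →ₗ[k] N →ₗ[k] Q)
    (hf : ∀ (m : M) (b : B) (n : N), f (op b • m) n = f m (b • n)) (m : M) (n : N) :
    BTensor.lift f hf (BTensor.tmul k B m n) = f m n := rfl

variable {M' : Type*} [AddCommGroup M'] [Module k M'] [Module Bᵐᵒᵖ M']
variable {N' : Type*} [AddCommGroup N'] [Module k N'] [Module B N']
variable [Algebra k B] [IsScalarTower k Bᵐᵒᵖ M] [IsScalarTower k Bᵐᵒᵖ M']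
variable [IsScalarTower k B N] [IsScalarTower k B N']

/-- The map `f ⊗_B N : m ⊗_B n ↦ f m ⊗_B n` for a right `B`-linear map `f`. -/
def BTensor.rTensor (N : Type*) [AddCommGroup N] [Module k N] [Module B N] (f : M →ₗ[Bᵐᵒᵖ] M') :
    BTensor k B M N →ₗ[k] BTensor k B M' N :=
  BTensor.lift
    (((TensorProduct.mk k M' N).compr₂ (BTensor.proj k B M' N)).comp (f.restrictScalars k))
    (fun m b n => by
      have := BTensor.smul_tmul (k := k) (f m) b n
      simpa [BTensor.tmul] using this)

/-- The map `M ⊗_B g : m ⊗_B n ↦ m ⊗_B g n` for a left `B`-linear map `g`. -/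
def BTensor.lTensor (M : Type*) [AddCommGroup M] [Module k M] [Module Bᵐᵒᵖ M] (g : N →ₗ[B] N') :
    BTensor k B M N →ₗ[k] BTensor k B M N' :=
  BTensor.lift
    (((TensorProduct.mk k M N').compr₂ (BTensor.proj k B M N')).compl₂ (g.restrictScalars k))
    (fun m b n => by
      have := BTensor.smul_tmul (k := k) m b (g n)
      simpa [BTensor.tmul] using this)

end BalancedTensor

/-! ### The right action on `M ⊗_B N` for a bimodule `N` -/

section RightAction

variable {k : Type*} [CommRing k] {B : Type*} [Ring B]
variable {M : Type*} [AddCommGroup M] [Module k M] [Module Bᵐᵒᵖ M]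
variable {N : Type*} [AddCommGroup N] [Module k N] [Module B N]

theorem BTensor.induction_on {p : BTensor k B M N → Prop} (x : BTensor k B M N)
    (h0 : p 0) (ht : ∀ m n, p (BTensor.tmul k B m n)) (ha : ∀ x y, p x → p y → p (x + y)) :
    p x := by
  obtain ⟨y, rfl⟩ := Submodule.Quotient.mk_surjective _ x
  induction y with
  | zero => exact h0
  | tmul m n => exact ht m n
  | add a b iha ihb => exact ha _ _ iha ihb

variable [Algebra k B] [IsScalarTower k B N]
variable {C : Type*} [Ring C] [Module Cᵐᵒᵖ N] [SMulCommClass Cᵐᵒᵖ B N]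

/-- The right action of `C` on `M ⊗_B N` for a `(B, C)`-bimodule `N`: `(m ⊗_B n) c = m ⊗_B n c`. -/
instance BTensor.instSMulOp : SMul Cᵐᵒᵖ (BTensor k B M N) where
  smul c x := BTensor.lTensor M
    ({ toFun := fun n => c • n, map_add' := smul_add c, map_smul' := fun b n => smul_comm c b n } :
      N →ₗ[B] N) x

@[simp]
theorem BTensor.op_smul_tmul (c : Cᵐᵒᵖ) (m : M) (n : N) :
    c • BTensor.tmul k B m n = BTensor.tmul k B m (c • n) := rfl

theorem BTensor.op_smul_add (c : Cᵐᵒᵖ) (x y : BTensor k B M N) : c • (x + y) = c • x + c • y :=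
  map_add (BTensor.lTensor M _) x y

theorem BTensor.op_smul_zero (c : Cᵐᵒᵖ) : c • (0 : BTensor k B M N) = 0 :=
  map_zero (BTensor.lTensor M _)

instance BTensor.instModuleOp : Module Cᵐᵒᵖ (BTensor k B M N) where
  smul_add := BTensor.op_smul_add
  smul_zero := BTensor.op_smul_zero
  one_smul x := by
    induction x using BTensor.induction_on with
    | h0 => exact BTensor.op_smul_zero _
    | ht m n => simp
    | ha x y hx hy => rw [BTensor.op_smul_add, hx, hy]
  mul_smul c d x := by
    induction x using BTensor.induction_on with
    | h0 => simp only [BTensor.op_smul_zero]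
    | ht m n => simp [mul_smul]
    | ha x y hx hy => simp only [BTensor.op_smul_add, hx, hy]
  add_smul c d x := by
    induction x using BTensor.induction_on with
    | h0 => simp only [BTensor.op_smul_zero, add_zero]
    | ht m n => simp [add_smul, BTensor.tmul_add]
    | ha x y hx hy => simp only [BTensor.op_smul_add, hx, hy]; abel
  zero_smul x := by
    induction x using BTensor.induction_on with
    | h0 => exact BTensor.op_smul_zero _
    | ht m n => rw [BTensor.op_smul_tmul, zero_smul]; simp [BTensor.tmul]
    | ha x y hx hy => rw [BTensor.op_smul_add, hx, hy, add_zero]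

instance BTensor.instSMulCommClassOp : SMulCommClass Cᵐᵒᵖ k (BTensor k B M N) where
  smul_comm _ a x := map_smul (BTensor.lTensor M _) a x

instance BTensor.instIsScalarTowerOp [Algebra k C] [IsScalarTower k Cᵐᵒᵖ N] :
    IsScalarTower k Cᵐᵒᵖ (BTensor k B M N) where
  smul_assoc a c x := by
    induction x using BTensor.induction_on with
    | h0 => simp only [smul_zero]
    | ht m n =>
      rw [BTensor.op_smul_tmul, BTensor.op_smul_tmul, smul_assoc]
      simp [BTensor.tmul, TensorProduct.tmul_smul]
    | ha x y hx hy => simp only [smul_add, hx, hy]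

end RightAction

/-! ### Faithful flatness -/

/-- A left `B`-module `N` is faithfully flat if a sequence `X → Y → Z` of right `B`-modules is exact
if and only if `X ⊗_B N → Y ⊗_B N → Z ⊗_B N` is exact. -/
def LeftFaithfullyFlat (k : Type*) [CommRing k] (B : Type*) [Ring B] [Algebra k B]
    (N : Type*) [AddCommGroup N] [Module k N] [Module B N] : Prop :=
  ∀ (X Y Z : Type w) [AddCommGroup X] [AddCommGroup Y] [AddCommGroup Z]
    [Module k X] [Module k Y] [Module k Z] [Module Bᵐᵒᵖ X] [Module Bᵐᵒᵖ Y] [Module Bᵐᵒᵖ Z]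
    [IsScalarTower k Bᵐᵒᵖ X] [IsScalarTower k Bᵐᵒᵖ Y] [IsScalarTower k Bᵐᵒᵖ Z]
    (f : X →ₗ[Bᵐᵒᵖ] Y) (g : Y →ₗ[Bᵐᵒᵖ] Z),
    Function.Exact (BTensor.rTensor (k := k) N f) (BTensor.rTensor (k := k) N g) ↔
      Function.Exact f g

/-! ### Comodule algebras and Hopf-Galois extensions -/

/-- A right `H`-comodule algebra structure on the `k`-algebra `A`: a coassociative and counital right
coaction `ρ : A → A ⊗ H` which is a morphism of `k`-algebras. -/
class RightComoduleAlgebra (k : Type*) [CommRing k] (H : Type*) [Ring H] [Bialgebra k H]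
    (A : Type*) [Ring A] [Algebra k A] where
  /-- the coaction `ρ(a) = a₀ ⊗ a₁` -/
  coact : A →ₐ[k] A ⊗[k] H
  coact_coassoc : ∀ a : A,
    TensorProduct.assoc k A H H (coact.toLinearMap.rTensor H (coact a)) =
      (Coalgebra.comul (R := k) (A := H)).lTensor A (coact a)
  coact_counit : ∀ a : A,
    TensorProduct.rid k A ((Coalgebra.counit (R := k) (A := H)).lTensor A (coact a)) = a

section ComoduleAlgebra

variable (k : Type*) [CommRing k] (H : Type*) [Ring H] [HopfAlgebra k H]
variable (A : Type*) [Ring A] [Algebra k A] [RightComoduleAlgebra k H A]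

/-- The coaction `ρ : A → A ⊗ H` of a right `H`-comodule algebra. -/
abbrev coact : A →ₐ[k] A ⊗[k] H := RightComoduleAlgebra.coact

/-- The subalgebra `A^{co H} = {a | ρ(a) = a ⊗ 1}` of coinvariants. -/
def coinv : Subalgebra k A :=
  AlgHom.equalizer (coact k H A) Algebra.TensorProduct.includeLeft

theorem coact_coinv (b : coinv k H A) : coact k H A (b : A) = (b : A) ⊗ₜ[k] 1 := b.2

/-- `A` as a right module over its coinvariants. -/
instance : Module (coinv k H A)ᵐᵒᵖ A :=
  Module.compHom A ((coinv k H A).val.toRingHom.op)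

theorem op_coinv_smul (b : coinv k H A) (a : A) : op b • a = a * (b : A) := rfl

instance : IsScalarTower k (coinv k H A)ᵐᵒᵖ A where
  smul_assoc c b a := by
    change a * (c • (b.unop : A)) = c • (a * (b.unop : A))
    simp

instance : SMulCommClass (coinv k H A)ᵐᵒᵖ (coinv k H A) A where
  smul_comm _ _ _ := mul_assoc _ _ _

/-- The canonical map `can : A ⊗_B A → A ⊗ H`, `can(a ⊗_B a') = a a'₀ ⊗ a'₁`, with
`B = A^{co H}`. -/
def can : BTensor k (coinv k H A) A A →ₗ[k] A ⊗[k] H :=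
  BTensor.lift
    (((LinearMap.mul k (A ⊗[k] H)).comp
      (Algebra.TensorProduct.includeLeft : A →ₐ[k] A ⊗[k] H).toLinearMap).compl₂
        (coact k H A).toLinearMap)
    (fun a b a' => by
      have h : coact k H A (b • a') = (b : A) ⊗ₜ[k] 1 * coact k H A a' := by
        rw [← coact_coinv, ← map_mul]; rfl
      simp [h, op_coinv_smul, ← mul_assoc])

theorem can_tmul (a a' : A) : can k H A (BTensor.tmul k _ a a') = a ⊗ₜ[k] 1 * coact k H A a' := rfl

/-- `A` is an `H`-Galois extension of its coinvariants. -/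
def IsHopfGalois : Prop := Function.Bijective (can k H A)

variable {k H A}

/-- The map `γ : H → A ⊗_B A`, `γ(h) = can⁻¹(1 ⊗ h) = ∑ lᵢ(h) ⊗_B rᵢ(h)`. -/
def IsHopfGalois.gamma (hA : IsHopfGalois k H A) : H →ₗ[k] BTensor k (coinv k H A) A A :=
  (LinearEquiv.ofBijective (can k H A) hA).symm.toLinearMap.comp (TensorProduct.mk k A H 1)

end ComoduleAlgebra

/-! ### The comodule algebra `E = END_A(M ⊗_B A)` -/

section Lifting

variable (k : Type*) [CommRing k] (H : Type*) [Ring H] [HopfAlgebra k H]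
variable (A : Type*) [Ring A] [Algebra k A] [RightComoduleAlgebra k H A]
variable (M : Type*) [AddCommGroup M] [Module k M] [Module (coinv k H A)ᵐᵒᵖ M]

/-- The induced module `M ⊗_B A`, where `B = A^{co H}`. -/
abbrev Ind : Type _ := BTensor k (coinv k H A) M A

/-- The coaction `ρ(m ⊗_B a) = (m ⊗_B a₀) ⊗ a₁` of the relative Hopf module `M ⊗_B A`. -/
def indCoact : Ind k H A M →ₗ[k] Ind k H A M ⊗[k] H :=
  BTensor.lift
    ((TensorProduct.mk k M (A ⊗[k] H)).compr₂
      (((BTensor.proj k (coinv k H A) M A).rTensor H).comp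
        (TensorProduct.assoc k M A H).symm.toLinearMap) |>.compl₂ (coact k H A).toLinearMap)
    (fun m b a => by
      have h : coact k H A (b • a) = (b : A) ⊗ₜ[k] 1 * coact k H A a := by
        rw [← coact_coinv, ← map_mul]; rfl
      simp only [LinearMap.compl₂_apply, AlgHom.toLinearMap_apply, h]
      induction coact k H A a with
      | zero => simp
      | add x y hx hy => simp only [mul_add, map_add, hx, hy]
      | tmul a' g =>
        have := BTensor.smul_tmul (k := k) m b a'
        simpa [BTensor.tmul, Subalgebra.smul_def] using congrArg (· ⊗ₜ[k] g) this)

/-- The algebra `End_A(M ⊗_B A)` of right `A`-linear endomorphisms. -/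
abbrev IndEnd : Type _ := Module.End Aᵐᵒᵖ (Ind k H A M)

/-- The algebra map `End_A(P) ⊗ H → End(P ⊗ H)`, `(f ⊗ h)(p ⊗ g) = f(p) ⊗ h g`, for
`P = M ⊗_B A`. -/
def endTensorAct : IndEnd k H A M ⊗[k] H →ₐ[k] Module.End Aᵐᵒᵖ (Ind k H A M ⊗[k] H) :=
  (Module.endTensorEndAlgHom (R := k) (S := k) (A := Aᵐᵒᵖ) (M := Ind k H A M) (N := H)).comp
    (Algebra.TensorProduct.map (AlgHom.id k (IndEnd k H A M)) (Algebra.lmul k H))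

variable {k H A M}

/-- `x = ∑ f₀ ⊗ f₁ ∈ End_A(P) ⊗ H` is the coaction of `f ∈ End_A(P)`, where `P = M ⊗_B A`, if
`ρ(f(p)) = ∑ f₀(p₀) ⊗ f₁ p₁` for all `p ∈ P`, equivalently if
`∑ f₀(p) ⊗ f₁ = f(p₀)₀ ⊗ f(p₀)₁ S(p₁)` for all `p ∈ P`. If `H` is projective over `k`, there is at
most one such `x`. -/
def IsCoactionOf (f : IndEnd k H A M) (x : IndEnd k H A M ⊗[k] H) : Prop :=
  ∀ p : Ind k H A M, indCoact k H A M (f p) = endTensorAct k H A M x (indCoact k H A M p)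

variable (k H A M)

/-- `E = END_A(M ⊗_B A)`: the algebra of rational endomorphisms, i.e. of those right `A`-linear
endomorphisms `f` for which there exists a coaction `∑ f₀ ⊗ f₁`. -/
def RatEnd : Subalgebra k (IndEnd k H A M) where
  carrier := {f | ∃ x, IsCoactionOf f x}
  mul_mem' := by
    rintro f g ⟨x, hx⟩ ⟨y, hy⟩
    exact ⟨x * y, fun p => by rw [map_mul, Module.End.mul_apply, Module.End.mul_apply, hx, hy]⟩
  add_mem' := by
    rintro f g ⟨x, hx⟩ ⟨y, hy⟩
    exact ⟨x + y, fun p => by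
      rw [map_add, LinearMap.add_apply, LinearMap.add_apply, map_add, hx, hy]⟩
  algebraMap_mem' c := ⟨algebraMap k _ c, fun p => by
    rw [AlgHom.commutes, Module.algebraMap_end_apply, Module.algebraMap_end_apply, map_smul]⟩

/-- The coinvariants `E^{co H}` of `E`: the `f ∈ E` whose coaction is `f ⊗ 1`. -/
def ratEndCoinv : Subalgebra k (RatEnd k H A M) where
  carrier := {f | IsCoactionOf (f : IndEnd k H A M) ((f : IndEnd k H A M) ⊗ₜ[k] 1)}
  mul_mem' := by
    rintro f g hf hg p
    have : ((f * g : RatEnd k H A M) : IndEnd k H A M) ⊗ₜ[k] (1 : H) =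
      ((f : IndEnd k H A M) ⊗ₜ[k] 1) * ((g : IndEnd k H A M) ⊗ₜ[k] 1) := by simp
    rw [this, map_mul, Module.End.mul_apply, ← hg p, ← hf (g.1 p)]
    rfl
  add_mem' := by
    rintro f g hf hg p
    have : ((f + g : RatEnd k H A M) : IndEnd k H A M) ⊗ₜ[k] (1 : H) =
      ((f : IndEnd k H A M) ⊗ₜ[k] 1) + ((g : IndEnd k H A M) ⊗ₜ[k] 1) := by
        simp [TensorProduct.add_tmul]
    rw [this, map_add, LinearMap.add_apply, ← hg p, ← hf p, ← map_add]
    rfl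
  algebraMap_mem' c p := by
    have : ((algebraMap k (RatEnd k H A M) c : RatEnd k H A M) : IndEnd k H A M) ⊗ₜ[k] (1 : H) =
      algebraMap k (IndEnd k H A M ⊗[k] H) c := rfl
    rw [this, AlgHom.commutes, Module.algebraMap_end_apply, ← map_smul]
    rfl

/-- `Ω_E`: the set of right `H`-colinear algebra maps `t : H → E`, where colinear means that
`t(h₁) ⊗ h₂` is the coaction of `t(h)`, for all `h ∈ H`. -/
def Omega : Set (H →ₐ[k] RatEnd k H A M) :=
  {t | ∀ h : H, IsCoactionOf (t h : IndEnd k H A M)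
    ((((RatEnd k H A M).val.comp t).toLinearMap.rTensor H) (Coalgebra.comul h))}

/-- `t₁ ∼ t₂` in `Ω_E` if and only if there exists a unit `u` of `E^{co H}` with
`u t₁(h) = t₂(h) u` for all `h ∈ H`. -/
instance Omega.setoid : Setoid (Omega k H A M) where
  r t₁ t₂ := ∃ u : (ratEndCoinv k H A M)ˣ, ∀ h : H,
    ((u : ratEndCoinv k H A M) : RatEnd k H A M) * t₁.1 h =
      t₂.1 h * ((u : ratEndCoinv k H A M) : RatEnd k H A M)
  iseqv := by
    refine ⟨fun t => ⟨1, fun h => by simp⟩, ?_, ?_⟩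
    · rintro t₁ t₂ ⟨u, hu⟩
      refine ⟨u⁻¹, fun h => ?_⟩
      have h1 : ((u⁻¹ : (ratEndCoinv k H A M)ˣ) : ratEndCoinv k H A M).1 *
          (u : ratEndCoinv k H A M).1 = 1 := congrArg Subtype.val u.inv_mul
      have h2 : (u : ratEndCoinv k H A M).1 *
          ((u⁻¹ : (ratEndCoinv k H A M)ˣ) : ratEndCoinv k H A M).1 = 1 :=
        congrArg Subtype.val u.mul_inv
      calc _ = ((u⁻¹ : (ratEndCoinv k H A M)ˣ) : ratEndCoinv k H A M).1 * (t₂.1 h *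
              (u : ratEndCoinv k H A M).1) *
              ((u⁻¹ : (ratEndCoinv k H A M)ˣ) : ratEndCoinv k H A M).1 := by
            rw [mul_assoc, mul_assoc, h2, mul_one]
        _ = _ := by rw [← hu h, ← mul_assoc, h1, one_mul]
    · rintro t₁ t₂ t₃ ⟨u, hu⟩ ⟨v, hv⟩
      refine ⟨v * u, fun h => ?_⟩
      push_cast
      rw [mul_assoc, hu, ← mul_assoc, hv, mul_assoc]

/-! ### Extensions of the action -/

/-- `Λ_M`: the set of right `B`-linear maps `φ : M ⊗_B A → M` such that `m · a = φ(m ⊗_B a)` is a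
(unital and associative) right `A`-module structure on `M`. -/
def Lam : Set (Ind k H A M →ₗ[(coinv k H A)ᵐᵒᵖ] M) :=
  {φ | (∀ m : M, φ (BTensor.tmul k _ m 1) = m) ∧
    ∀ (m : M) (a a' : A), φ (BTensor.tmul k _ (φ (BTensor.tmul k _ m a)) a') =
      φ (BTensor.tmul k _ m (a * a'))}

/-- A right `A`-module structure on (the additive group of) `M` that extends the right action of
`B = A^{co H}`. -/
def ModuleExt : Type _ :=
  {s : Module Aᵐᵒᵖ M // ∀ (b : coinv k H A) (m : M), s.smul (op (b : A)) m = op b • m}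

/-- Two right `A`-module structures on `M` extending the `B`-action are equivalent if the resulting
right `A`-modules are isomorphic. -/
instance ModuleExt.setoid : Setoid (ModuleExt k H A M) where
  r s₁ s₂ := Nonempty
    (@LinearEquiv Aᵐᵒᵖ Aᵐᵒᵖ _ _ (RingHom.id _) (RingHom.id _) _ _ M M _ _ s₁.1 s₂.1)
  iseqv :=
    { refl := fun s => ⟨@LinearEquiv.refl Aᵐᵒᵖ M _ _ s.1⟩
      symm := fun {s₁ s₂} ⟨e⟩ => ⟨@LinearEquiv.symm _ _ _ _ _ _ _ _ s₁.1 s₂.1 _ _ _ _ e⟩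
      trans := fun {s₁ s₂ s₃} ⟨e⟩ ⟨f⟩ =>
        ⟨@LinearEquiv.trans _ _ _ _ _ _ _ _ _ _ _ _ s₁.1 s₂.1 s₃.1
          (RingHom.id _) (RingHom.id _) (RingHom.id _) (RingHom.id _) (RingHom.id _) (RingHom.id _)
          _ _ _ _ _ _ _ _ e f⟩ }

variable {k H A M}

/-- The right `A`-module structure `m · a = φ(m ⊗_B a)` on `M` given by `φ ∈ Λ_M`. -/
def Lam.toModuleExt (φ : Lam k H A M) : ModuleExt k H A M :=
  ⟨{ smul := fun a m => φ.1 (BTensor.tmul k _ m a.unop)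
     one_smul := φ.2.1
     mul_smul := fun a a' m => (φ.2.2 m a'.unop a.unop).symm
     smul_zero := fun a => by
       change φ.1 (BTensor.tmul k _ 0 a.unop) = 0
       simp [BTensor.tmul]
     smul_add := fun a m m' => by
       change φ.1 (BTensor.tmul k _ (m + m') a.unop) = φ.1 _ + φ.1 _
       simp [BTensor.tmul, TensorProduct.add_tmul]
     add_smul := fun a a' m => by
       change φ.1 (BTensor.tmul k _ m (a.unop + a'.unop)) = φ.1 _ + φ.1 _
       simp [BTensor.tmul_add]
     zero_smul := fun m => by
       change φ.1 (BTensor.tmul k _ m 0) = 0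
       simp [BTensor.tmul] },
    fun b m => by
      change φ.1 (BTensor.tmul k _ m (b : A)) = op b • m
      have h : BTensor.tmul k (coinv k H A) m (b : A) = op b • BTensor.tmul k _ m (1 : A) := by
        rw [BTensor.op_smul_tmul, op_coinv_smul, one_mul]
      rw [h, map_smul, φ.2.1]⟩

variable (k H A M)

/-- `φ₁ ∼ φ₂` in `Λ_M` if and only if the resulting right `A`-modules are isomorphic. -/
instance Lam.setoid : Setoid (Lam k H A M) :=
  (ModuleExt.setoid k H A M).comap Lam.toModuleExt

variable {k H A M}

/-- For `m ∈ M` and `a ∈ A`, the map `A ⊗_B A → M ⊗_B A`, `l ⊗_B r ↦ φ(m ⊗_B l) ⊗_B r a`. -/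
def sweep [IsScalarTower k (coinv k H A)ᵐᵒᵖ M]
    (φ : Ind k H A M →ₗ[(coinv k H A)ᵐᵒᵖ] M) (m : M) (a : A) :
    BTensor k (coinv k H A) A A →ₗ[k] Ind k H A M :=
  BTensor.lift
    ((((TensorProduct.mk k M A).compr₂ (BTensor.proj k (coinv k H A) M A)).compl₂
        (LinearMap.mulRight k a)).comp
      ((φ.restrictScalars k).comp ((BTensor.proj k (coinv k H A) M A).comp
        (TensorProduct.mk k M A m))))
    (fun l b r => by
      have h1 : φ (BTensor.tmul k _ m (op b • l)) = op b • φ (BTensor.tmul k _ m l) := by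
        rw [← BTensor.op_smul_tmul, map_smul]
      have h2 : b • r * a = b • (r * a) := smul_mul_assoc b r a
      change BTensor.tmul k _ (φ (BTensor.tmul k _ m (op b • l))) (r * a) =
        BTensor.tmul k _ (φ (BTensor.tmul k _ m l)) ((b • r) * a)
      rw [h1, h2, BTensor.smul_tmul])

theorem sweep_tmul [IsScalarTower k (coinv k H A)ᵐᵒᵖ M]
    (φ : Ind k H A M →ₗ[(coinv k H A)ᵐᵒᵖ] M) (m : M) (a l r : A) :
    sweep φ m a (BTensor.tmul k _ l r) =
      BTensor.tmul k _ (φ (BTensor.tmul k _ m l)) (r * a) := rfl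

end Lifting

end HopfGalois

end

/-! Write P = M ⊗_B A and γ(h) = can⁻¹(1 ⊗ h). Everything rests on the inverse of φ ↦ t. Given a
colinear algebra map t, put π(p) = ∑ t(S⁻¹(p₁))(p₀) (`twist`). Colinearity of t and ∑ Δ(S⁻¹(h₂))(1 ⊗
h₁) = S⁻¹(h) ⊗ 1 make π(p) coinvariant (`indCoact_twist`). By descent the coinvariants of P are
exactly M ⊗ 1, a copy of M (`indUnit_injective`, `mem_range_indUnit`), so φ(p) ⊗ 1 = π(p) defines φ.
Since S⁻¹ reverses products and the values of t are A-linear, π(π(p)a) = π(pa), which is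
associativity of φ.

The two constructions are mutually inverse by ∑ t(p₁)(π(p₀)) = p (`endEval_rTensor_twist`) in one
direction and ∑ γ(S⁻¹(a₁)) a₀ = a ⊗ 1 (`indRightAct_gamma_antipodeInv`) in the other. That φ gives
an element of Ω_E comes from properties of γ read off through can: it commutes with B, it is
colinear, and inserting γ(g) between the factors of γ(h) gives γ(gh).

Descent also identifies E^{co H} with End_B(M) through f ↦ f ⊗_B A. Both passages between φ and t
are natural in f, so one and the same automorphism f of M implements φ₁ ∼ φ₂ and t₁ ∼ t₂. -/

noncomputable section

namespace HopfGalois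

/-! ### The antipode, its inverse and the comultiplication -/

section Antipode

open Coalgebra HopfAlgebra WithConv

variable {k : Type*} [CommRing k] {H : Type*} [Ring H] [HopfAlgebra k H]

variable (k H) in
/-- The map `x ⊗ y ↦ S(y) ⊗ S(x)`. -/
def antipodeFlip : H ⊗[k] H →ₗ[k] H ⊗[k] H :=
  (TensorProduct.map (antipode k) (antipode k)).comp (TensorProduct.comm k H H).toLinearMap

@[simp]
theorem antipodeFlip_tmul (x y : H) :
    antipodeFlip k H (x ⊗ₜ y) = antipode k y ⊗ₜ antipode k x := rfl

/-- Composition with an algebra map preserves convolution products, so S * id = 1 is carried to f ∘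
S and f. -/
theorem convMul_antipode_comp {C : Type*} [Ring C] [Algebra k C] (f : H →ₐ[k] C) :
    toConv (f.toLinearMap ∘ₗ antipode k) * toConv f.toLinearMap = 1 := by
  have h := LinearMap.algHom_comp_convMul_distrib f
    (toConv (antipode k (A := H))) (toConv LinearMap.id)
  rw [LinearMap.antipode_mul_id] at h
  apply WithConv.ofConv_injective
  refine Eq.trans h.symm ?_
  ext x
  simp [LinearMap.convOne_def]

/-- With i, j the two inclusions H → H ⊗ H, Δ = i * j and the flipped map is (j ∘ S) * (i ∘ S), so
the product telescopes. -/
theorem antipodeFlip_comul_convMul_comul :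
    toConv (antipodeFlip k H ∘ₗ comul) * toConv (comul (R := k) (A := H)) = 1 := by
  let i : H →ₐ[k] H ⊗[k] H := Algebra.TensorProduct.includeLeft
  let j : H →ₐ[k] H ⊗[k] H := Algebra.TensorProduct.includeRight
  have h1 : toConv (antipodeFlip k H ∘ₗ comul) =
      toConv (j.toLinearMap ∘ₗ antipode k) * toConv (i.toLinearMap ∘ₗ antipode k) := by
    refine WithConv.ofConv_injective (LinearMap.ext fun x => ?_)
    refine LinearMap.congr_fun (f := antipodeFlip k H) (g := LinearMap.mul' k _ ∘ₗ
      TensorProduct.map (j.toLinearMap ∘ₗ antipode k) (i.toLinearMap ∘ₗ antipode k)) ?_ (comul x)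
    ext x y
    simp [i, j]
  have h2 : toConv (comul (R := k) (A := H)) = toConv i.toLinearMap * toConv j.toLinearMap := by
    refine WithConv.ofConv_injective (LinearMap.ext fun x => ?_)
    refine LinearMap.congr_fun (f := LinearMap.id) (g := LinearMap.mul' k _ ∘ₗ
      TensorProduct.map i.toLinearMap j.toLinearMap) ?_ (comul x)
    ext x y
    simp [i, j]
  rw [h1, h2, mul_assoc, ← mul_assoc (toConv (i.toLinearMap ∘ₗ antipode k)),
    convMul_antipode_comp, one_mul, convMul_antipode_comp]

/-- Both maps are convolution inverses of Δ, one on the left and the other on the right, hence they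
coincide. -/
theorem comul_antipode (h : H) : comul (R := k) (antipode k h) = antipodeFlip k H (comul h) := by
  have h1 : antipodeFlip k H ∘ₗ comul = comul (R := k) ∘ₗ antipode k :=
    toConv_injective (left_inv_eq_right_inv antipodeFlip_comul_convMul_comul
      LinearMap.comul_right_inv)
  exact (LinearMap.congr_fun h1 h).symm

/-- The inverse of a bijective antipode. -/
def antipodeInv (hS : Function.Bijective (antipode k : H →ₗ[k] H)) : H →ₗ[k] H :=
  (LinearEquiv.ofBijective (antipode k) hS).symm.toLinearMap

variable (hS : Function.Bijective (antipode k : H →ₗ[k] H))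

@[simp]
theorem antipode_antipodeInv (h : H) : antipode k (antipodeInv hS h) = h :=
  (LinearEquiv.ofBijective (antipode k) hS).apply_symm_apply h

@[simp]
theorem antipodeInv_antipode (h : H) : antipodeInv hS (antipode k h) = h :=
  (LinearEquiv.ofBijective (antipode k) hS).symm_apply_apply h

@[simp]
theorem antipodeInv_one : antipodeInv hS 1 = 1 := by
  rw [← antipode_one (R := k), antipodeInv_antipode, antipode_one]

theorem antipodeInv_mul (g h : H) :
    antipodeInv hS (g * h) = antipodeInv hS h * antipodeInv hS g := by
  apply hS.1
  rw [antipode_mul_antidistrib]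
  simp

/-- `∑ h₂ S⁻¹(h₁) = ε(h)`. -/
theorem mul_antipodeInv_comul (h : H) :
    LinearMap.mul' k H (TensorProduct.map LinearMap.id (antipodeInv hS)
      (TensorProduct.comm k H H (comul h))) = algebraMap k H (counit h) := by
  -- With h = S(x), Δ(h) = ∑ S(x₂) ⊗ S(x₁), and the claim becomes ∑ S(x₁) x₂ = ε(x).
  obtain ⟨x, rfl⟩ := hS.2 h
  rw [comul_antipode, counit_antipode, ← mul_antipode_rTensor_comul_apply]
  refine LinearMap.congr_fun (f := LinearMap.mul' k H ∘ₗ TensorProduct.map LinearMap.id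
    (antipodeInv hS) ∘ₗ (TensorProduct.comm k H H).toLinearMap ∘ₗ antipodeFlip k H)
    (g := LinearMap.mul' k H ∘ₗ (antipode k).rTensor H) ?_ (comul x)
  ext x y
  simp

/-- `∑ S⁻¹(h₂) h₁ = ε(h)`. -/
theorem antipodeInv_mul_comul (h : H) :
    LinearMap.mul' k H (TensorProduct.map (antipodeInv hS) LinearMap.id
      (TensorProduct.comm k H H (comul h))) = algebraMap k H (counit h) := by
  obtain ⟨x, rfl⟩ := hS.2 h
  rw [comul_antipode, counit_antipode, ← mul_antipode_lTensor_comul_apply]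
  refine LinearMap.congr_fun (f := LinearMap.mul' k H ∘ₗ TensorProduct.map (antipodeInv hS)
    LinearMap.id ∘ₗ (TensorProduct.comm k H H).toLinearMap ∘ₗ antipodeFlip k H)
    (g := LinearMap.mul' k H ∘ₗ (antipode k).lTensor H) ?_ (comul x)
  ext x y
  simp

/-- The map `x ⊗ y ↦ Δ(S⁻¹(y)) (1 ⊗ x)`. -/
def comulAntipodeInvMul : H ⊗[k] H →ₗ[k] H ⊗[k] H :=
  LinearMap.mul' k (H ⊗[k] H) ∘ₗ TensorProduct.map (comul ∘ₗ antipodeInv hS)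
    (TensorProduct.mk k H H 1) ∘ₗ (TensorProduct.comm k H H).toLinearMap

@[simp]
theorem comulAntipodeInvMul_tmul (x y : H) :
    comulAntipodeInvMul hS (x ⊗ₜ y) = comul (R := k) (antipodeInv hS y) * 1 ⊗ₜ x := rfl

/-- `∑ Δ(S⁻¹(h₂)) (1 ⊗ h₁) = S⁻¹(h) ⊗ 1`. -/
theorem comulAntipodeInvMul_comul (h : H) :
    comulAntipodeInvMul hS (comul h) = antipodeInv hS h ⊗ₜ 1 := by
  obtain ⟨x, rfl⟩ := hS.2 h
  let i : H →ₐ[k] H ⊗[k] H := Algebra.TensorProduct.includeLeft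
  let j : H →ₐ[k] H ⊗[k] H := Algebra.TensorProduct.includeRight
  rw [comul_antipode, antipodeInv_antipode]
  -- With h = S(x) the left side is ∑ Δ(x₁)(1 ⊗ S(x₂)) = ∑ x₁ ⊗ x₂ S(x₃) = x ⊗ 1; `X` is a ⊗ b ⊗ c ↦
  -- a ⊗ b S(c).
  let X : H ⊗[k] (H ⊗[k] H) →ₗ[k] H ⊗[k] H :=
    (LinearMap.mul' k H ∘ₗ (antipode k).lTensor H).lTensor H
  have h1 : comulAntipodeInvMul hS (antipodeFlip k H (comul x)) =
      X (TensorProduct.assoc k H H H (comul.rTensor H (comul x))) := by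
    refine LinearMap.congr_fun (f := comulAntipodeInvMul hS ∘ₗ antipodeFlip k H)
      (g := X ∘ₗ (TensorProduct.assoc k H H H).toLinearMap ∘ₗ comul.rTensor H) ?_ (comul x)
    ext x y
    simp only [LinearMap.comp_apply, TensorProduct.AlgebraTensorModule.curry_apply,
      LinearMap.restrictScalars_apply, TensorProduct.curry_apply, antipodeFlip_tmul,
      comulAntipodeInvMul_tmul, antipodeInv_antipode, LinearMap.rTensor_tmul,
      LinearEquiv.coe_coe]
    induction comul (R := k) x with
    | zero => simp
    | add a b ha hb => simp only [add_mul, TensorProduct.add_tmul, map_add, ha, hb]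
    | tmul a b => simp [X]
  rw [h1, coassoc_apply]
  have h2 : X ∘ₗ comul.lTensor H = (Algebra.linearMap k H ∘ₗ counit).lTensor H := by
    rw [← mul_antipode_lTensor_comul, ← LinearMap.lTensor_comp, LinearMap.comp_assoc]
  have h3 := LinearMap.congr_fun h2 (comul x)
  rw [LinearMap.comp_apply] at h3
  rw [h3, LinearMap.lTensor_comp, LinearMap.comp_apply, lTensor_counit_comul]
  simp

end Antipode

/-! ### The relative Hopf module M ⊗_B A -/

section InducedModule

variable {k : Type*} [CommRing k] {H : Type*} [Ring H] [HopfAlgebra k H]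
variable {A : Type*} [Ring A] [Algebra k A] [RightComoduleAlgebra k H A]
variable {M : Type*} [AddCommGroup M] [Module k M] [Module (coinv k H A)ᵐᵒᵖ M]

theorem BTensor.add_tmul {B : Type*} [Ring B] {X : Type*} [AddCommGroup X] [Module k X]
    [Module Bᵐᵒᵖ X] {N : Type*} [AddCommGroup N] [Module k N] [Module B N] (x x' : X) (n : N) :
    BTensor.tmul k B (x + x') n = BTensor.tmul k B x n + BTensor.tmul k B x' n := by
  simp [BTensor.tmul, TensorProduct.add_tmul]

theorem BTensor.smul_tmul_left {B : Type*} [Ring B] {X : Type*} [AddCommGroup X] [Module k X]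
    [Module Bᵐᵒᵖ X] {N : Type*} [AddCommGroup N] [Module k N] [Module B N] (c : k) (x : X) (n : N) :
    BTensor.tmul k B (c • x) n = c • BTensor.tmul k B x n := by
  simp [BTensor.tmul, ← TensorProduct.smul_tmul']

theorem BTensor.zero_tmul {B : Type*} [Ring B] {X : Type*} [AddCommGroup X] [Module k X]
    [Module Bᵐᵒᵖ X] {N : Type*} [AddCommGroup N] [Module k N] [Module B N] (n : N) :
    BTensor.tmul k B (0 : X) n = 0 := by
  simp [BTensor.tmul]

@[simp]
theorem BTensor.rTensor_tmul {B : Type*} [Ring B] [Algebra k B]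
    {X : Type*} [AddCommGroup X] [Module k X] [Module Bᵐᵒᵖ X] [IsScalarTower k Bᵐᵒᵖ X]
    {X' : Type*} [AddCommGroup X'] [Module k X'] [Module Bᵐᵒᵖ X'] [IsScalarTower k Bᵐᵒᵖ X']
    {N : Type*} [AddCommGroup N] [Module k N] [Module B N]
    (f : X →ₗ[Bᵐᵒᵖ] X') (x : X) (n : N) :
    BTensor.rTensor N f (BTensor.tmul k B x n) = BTensor.tmul k B (f x) n := rfl

variable (k H A) in
/-- The `k`-linear map `a ↦ m ⊗_B a`. -/
def indMk (m : M) : A →ₗ[k] Ind k H A M :=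
  BTensor.proj k (coinv k H A) M A ∘ₗ TensorProduct.mk k M A m

@[simp]
theorem indMk_apply (m : M) (a : A) : indMk k H A m a = BTensor.tmul k _ m a := rfl

theorem indCoact_tmul (m : M) (a : A) :
    indCoact k H A M (BTensor.tmul k _ m a) = (indMk k H A m).rTensor H (coact k H A a) := by
  change ((BTensor.proj k (coinv k H A) M A).rTensor H)
    ((TensorProduct.assoc k M A H).symm (m ⊗ₜ coact k H A a)) = _
  induction coact k H A a with
  | zero => simp
  | add x y hx hy => simp only [TensorProduct.tmul_add, map_add, hx, hy]
  | tmul a g => rfl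

theorem indCoact_comp_indMk (m : M) :
    indCoact k H A M ∘ₗ indMk k H A m = (indMk k H A m).rTensor H ∘ₗ (coact k H A).toLinearMap :=
  LinearMap.ext fun a => indCoact_tmul m a

theorem indCoact_coassoc (p : Ind k H A M) :
    TensorProduct.assoc k _ H H ((indCoact k H A M).rTensor H (indCoact k H A M p)) =
      (Coalgebra.comul (R := k) (A := H)).lTensor _ (indCoact k H A M p) := by
  induction p using BTensor.induction_on with
  | h0 => simp
  | ha x y hx hy => simp only [map_add, hx, hy]
  | ht m a =>
    rw [indCoact_tmul, ← LinearMap.comp_apply (LinearMap.rTensor H _), ← LinearMap.rTensor_comp,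
      indCoact_comp_indMk, LinearMap.rTensor_comp, LinearMap.comp_apply]
    have h1 : ∀ z, TensorProduct.assoc k _ H H (((indMk k H A m).rTensor H).rTensor H z) =
        (indMk k H A m).rTensor (H ⊗[k] H) (TensorProduct.assoc k A H H z) := fun z =>
      LinearMap.congr_fun (f := (TensorProduct.assoc k _ H H).toLinearMap ∘ₗ
        ((indMk k H A m).rTensor H).rTensor H) (g := (indMk k H A m).rTensor (H ⊗[k] H) ∘ₗ
        (TensorProduct.assoc k A H H).toLinearMap) (by ext; simp) z
    rw [h1, RightComoduleAlgebra.coact_coassoc, ← LinearMap.comp_apply, ← LinearMap.comp_apply,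
      LinearMap.rTensor_comp_lTensor, LinearMap.lTensor_comp_rTensor]

theorem indCoact_counit (p : Ind k H A M) :
    TensorProduct.rid k _ ((Coalgebra.counit (R := k) (A := H)).lTensor _ (indCoact k H A M p)) =
      p := by
  induction p using BTensor.induction_on with
  | h0 => simp
  | ha x y hx hy => simp only [map_add, hx, hy]
  | ht m a =>
    rw [indCoact_tmul, ← LinearMap.comp_apply, LinearMap.lTensor_comp_rTensor,
      ← LinearMap.rTensor_comp_lTensor, LinearMap.comp_apply]
    have h1 : ∀ z, TensorProduct.rid k _ ((indMk k H A m).rTensor k z) =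
        indMk k H A m (TensorProduct.rid k A z) := fun z =>
      LinearMap.congr_fun (f := (TensorProduct.rid k _).toLinearMap ∘ₗ
        (indMk k H A m).rTensor k) (g := indMk k H A m ∘ₗ
        (TensorProduct.rid k A).toLinearMap) (by ext; simp) z
    rw [h1, RightComoduleAlgebra.coact_counit, indMk_apply]

variable (k H A M) in
/-- The right action of `A` on `M ⊗_B A` as a bilinear map `a ↦ p ↦ p a`. -/
def indRightAct : A →ₗ[k] Ind k H A M →ₗ[k] Ind k H A M :=
  (Algebra.lsmul k k (Ind k H A M) : Aᵐᵒᵖ →ₐ[k] _).toLinearMap ∘ₗ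
    (opLinearEquiv k : A ≃ₗ[k] Aᵐᵒᵖ).toLinearMap

@[simp]
theorem indRightAct_apply (a : A) (p : Ind k H A M) : indRightAct k H A M a p = op a • p := rfl

variable (k H A M) in
/-- The right action of `A ⊗ H` on `(M ⊗_B A) ⊗ H`. -/
def indTensorRightAct : A ⊗[k] H →ₗ[k] Ind k H A M ⊗[k] H →ₗ[k] Ind k H A M ⊗[k] H :=
  TensorProduct.map₂ (indRightAct k H A M) (LinearMap.mul k H).flip

@[simp]
theorem indTensorRightAct_tmul (a : A) (h : H) (p : Ind k H A M) (g : H) :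
    indTensorRightAct k H A M (a ⊗ₜ h) (p ⊗ₜ g) = (op a • p) ⊗ₜ (g * h) := rfl

theorem indCoact_op_smul (a : A) (p : Ind k H A M) :
    indCoact k H A M (op a • p) = indTensorRightAct k H A M (coact k H A a)
      (indCoact k H A M p) := by
  induction p using BTensor.induction_on with
  | h0 => simp
  | ha x y hx hy => simp only [smul_add, map_add, hx, hy]
  | ht m c =>
    rw [BTensor.op_smul_tmul, indCoact_tmul, indCoact_tmul, op_smul_eq_mul, map_mul]
    induction coact k H A c with
    | zero => simp
    | add x y hx hy => simp only [add_mul, map_add, hx, hy]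
    | tmul c g =>
      induction coact k H A a with
      | zero => simp
      | add x y hx hy => simp only [mul_add, map_add, LinearMap.add_apply, hx, hy]
      | tmul a h => simp

/-- The bimodule construction gives M ⊗_B A a right B-action and a right A-action separately; this
reconciles them, so that A-linear maps can be used as B-linear ones. -/
theorem op_coinv_smul_ind (b : coinv k H A) (p : Ind k H A M) : op b • p = op (b : A) • p := by
  induction p using BTensor.induction_on with
  | h0 => simp
  | ha x y hx hy => simp only [smul_add, hx, hy]
  | ht m c => rfl

theorem op_smul_tmul_one (m : M) (a : A) :
    op a • BTensor.tmul k (coinv k H A) m (1 : A) = BTensor.tmul k _ m a := by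
  rw [BTensor.op_smul_tmul, op_smul_eq_mul, one_mul]

theorem indCoact_tmul_one (m : M) :
    indCoact k H A M (BTensor.tmul k _ m 1) = BTensor.tmul k _ m 1 ⊗ₜ 1 := by
  rw [indCoact_tmul, map_one, Algebra.TensorProduct.one_def]
  simp

@[simp]
theorem endTensorAct_tmul (f : IndEnd k H A M) (h : H) (p : Ind k H A M) (g : H) :
    endTensorAct k H A M (f ⊗ₜ h) (p ⊗ₜ g) = f p ⊗ₜ (h * g) := rfl

theorem endTensorAct_indTensorRightAct (y : IndEnd k H A M ⊗[k] H) (z : A ⊗[k] H)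
    (q : Ind k H A M ⊗[k] H) :
    endTensorAct k H A M y (indTensorRightAct k H A M z q) =
      indTensorRightAct k H A M z (endTensorAct k H A M y q) := by
  induction y with
  | zero => simp
  | add x y hx hy => simp only [map_add, LinearMap.add_apply, hx, hy]
  | tmul f g =>
    induction z with
    | zero => simp
    | add x y hx hy => simp only [map_add, LinearMap.add_apply, hx, hy]
    | tmul a h =>
      induction q with
      | zero => simp
      | add x y hx hy => simp only [map_add, hx, hy]
      | tmul p h' => simp [mul_assoc]

/-- An equality of coactions may be checked on the generators `m ⊗_B 1`. -/
theorem isCoactionOf_of_tmul_one {f : IndEnd k H A M} {y : IndEnd k H A M ⊗[k] H}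
    (h : ∀ m : M, indCoact k H A M (f (BTensor.tmul k _ m 1)) =
      endTensorAct k H A M y (BTensor.tmul k _ m 1 ⊗ₜ 1)) : IsCoactionOf f y := by
  intro p
  induction p using BTensor.induction_on with
  | h0 => simp
  | ha x y hx hy => simp only [map_add, hx, hy]
  | ht m a =>
    -- The coinvariant elements m ⊗ 1 generate over A, and left multiplication on H commutes with
    -- the right action of A ⊗ H.
    rw [← op_smul_tmul_one, map_smul, indCoact_op_smul, indCoact_op_smul, h,
      endTensorAct_indTensorRightAct, indCoact_tmul_one]

/-- Right `A`-linear maps out of `M ⊗_B A` that agree on the elements `m ⊗_B 1` are equal. -/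
theorem indEnd_ext {f g : IndEnd k H A M}
    (h : ∀ m : M, f (BTensor.tmul k _ m 1) = g (BTensor.tmul k _ m 1)) : f = g := by
  ext p
  induction p using BTensor.induction_on with
  | h0 => simp
  | ha x y hx hy => simp only [map_add, hx, hy]
  | ht m a => rw [← op_smul_tmul_one, map_smul, map_smul, h]

variable (k H A M) in
/-- The right `B`-linear map `m ↦ m ⊗_B 1`. -/
def indUnit : M →ₗ[(coinv k H A)ᵐᵒᵖ] Ind k H A M where
  toFun m := BTensor.tmul k _ m 1
  map_add' m m' := BTensor.add_tmul m m' 1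
  map_smul' b m := by
    have := BTensor.smul_tmul (k := k) m b.unop (1 : A)
    rw [op_unop] at this
    rw [this, RingHom.id_apply, BTensor.op_smul_tmul]
    congr 1
    exact (mul_one _).trans (one_mul _).symm

@[simp]
theorem indUnit_apply (m : M) :
    indUnit k H A M m = BTensor.tmul k _ m 1 := rfl

variable (k H A) in
/-- The right `B`-linear map `a ↦ m ⊗_B a`. -/
def indIncl (m : M) : A →ₗ[(coinv k H A)ᵐᵒᵖ] Ind k H A M where
  toFun a := BTensor.tmul k _ m a
  map_add' := BTensor.tmul_add m
  map_smul' _ _ := rfl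

@[simp]
theorem indIncl_apply (m : M) (a : A) : indIncl k H A m a = BTensor.tmul k _ m a := rfl

variable (k H A) in
/-- Left multiplication by `a` as a right `B`-linear map. -/
def coinvMulLeft (a : A) : A →ₗ[(coinv k H A)ᵐᵒᵖ] A where
  toFun c := a * c
  map_add' := mul_add a
  map_smul' b c := (mul_assoc a c (b.unop : A)).symm

@[simp]
theorem coinvMulLeft_apply (a c : A) : coinvMulLeft k H A a c = a * c := rfl

end InducedModule

/-! ### The canonical map and the descent sequence -/

section Descent

variable {k : Type*} [CommRing k] {H : Type*} [Ring H] [HopfAlgebra k H]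
variable {A : Type*} [Ring A] [Algebra k A] [RightComoduleAlgebra k H A]

theorem can_rTensor_coinvMulLeft (a : A) (x : BTensor k (coinv k H A) A A) :
    can k H A (BTensor.rTensor A (coinvMulLeft k H A a) x) = a ⊗ₜ 1 * can k H A x := by
  induction x using BTensor.induction_on with
  | h0 => simp
  | ha x y hx hy => simp only [map_add, mul_add, hx, hy]
  | ht c d =>
    rw [BTensor.rTensor_tmul, can_tmul, can_tmul, ← mul_assoc]
    simp

/-- Multiplicativity of ρ. Together with left A-linearity of `can` it turns identities in A ⊗_B A
into computations in the algebra A ⊗ H. -/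
theorem can_op_smul (a : A) (x : BTensor k (coinv k H A) A A) :
    can k H A (op a • x) = can k H A x * coact k H A a := by
  induction x using BTensor.induction_on with
  | h0 => simp
  | ha x y hx hy => simp only [smul_add, map_add, add_mul, hx, hy]
  | ht c d => rw [BTensor.op_smul_tmul, can_tmul, can_tmul, op_smul_eq_mul, map_mul, mul_assoc]

/-- The inverse of the canonical map. -/
def IsHopfGalois.canInv (hA : IsHopfGalois k H A) : A ⊗[k] H →ₗ[k] BTensor k (coinv k H A) A A :=
  (LinearEquiv.ofBijective (can k H A) hA).symm.toLinearMap

namespace IsHopfGalois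

variable (hA : IsHopfGalois k H A)

@[simp]
theorem can_canInv (z : A ⊗[k] H) : can k H A (hA.canInv z) = z :=
  (LinearEquiv.ofBijective (can k H A) hA).apply_symm_apply z

@[simp]
theorem canInv_can (x : BTensor k (coinv k H A) A A) : hA.canInv (can k H A x) = x :=
  (LinearEquiv.ofBijective (can k H A) hA).symm_apply_apply x

@[simp]
theorem can_gamma (h : H) : can k H A (hA.gamma h) = 1 ⊗ₜ h := hA.can_canInv _

theorem canInv_coact (a : A) : hA.canInv (coact k H A a) = BTensor.tmul k _ 1 a := by
  rw [← hA.canInv_can (BTensor.tmul k _ 1 a), can_tmul, ← Algebra.TensorProduct.one_def, one_mul]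

theorem canInv_tmul_one (a : A) : hA.canInv (a ⊗ₜ 1) = BTensor.tmul k _ a 1 := by
  rw [← hA.canInv_can (BTensor.tmul k _ a 1), can_tmul, map_one, mul_one]

theorem canInv_mul_left (a : A) (z : A ⊗[k] H) :
    hA.canInv (a ⊗ₜ 1 * z) = BTensor.rTensor A (coinvMulLeft k H A a) (hA.canInv z) := by
  rw [← hA.canInv_can (BTensor.rTensor A _ _), can_rTensor_coinvMulLeft, can_canInv]

end IsHopfGalois

variable {M : Type*} [AddCommGroup M] [Module k M] [Module (coinv k H A)ᵐᵒᵖ M]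
variable {M' : Type*} [AddCommGroup M'] [Module k M'] [Module (coinv k H A)ᵐᵒᵖ M']

variable (k H A M) in
/-- The map `m ↦ (l ⊗_B r ↦ (m ⊗_B l) ⊗_B r)`. -/
def indInclTensor : M →ₗ[k] BTensor k (coinv k H A) A A →ₗ[k] Ind k H A (Ind k H A M) where
  toFun m := BTensor.rTensor A (indIncl k H A m)
  map_add' m m' := BTensor.hom_ext fun l r => by simp [BTensor.add_tmul]
  map_smul' c m := BTensor.hom_ext fun l r => by simp [BTensor.smul_tmul_left]

@[simp]
theorem indInclTensor_tmul (m : M) (l r : A) :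
    indInclTensor k H A M m (BTensor.tmul k _ l r) = BTensor.tmul k _ (BTensor.tmul k _ m l) r :=
  rfl

/-- The map `(M ⊗_B A) ⊗ H → (M ⊗_B A) ⊗_B A` induced by the inverse of the canonical map. -/
def IsHopfGalois.indCanInv (hA : IsHopfGalois k H A) (M : Type*) [AddCommGroup M] [Module k M]
    [Module (coinv k H A)ᵐᵒᵖ M] : Ind k H A M ⊗[k] H →ₗ[k] Ind k H A (Ind k H A M) :=
  TensorProduct.lift <| BTensor.lift
    { toFun := fun m => TensorProduct.curry (indInclTensor k H A M m ∘ₗ hA.canInv)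
      map_add' := fun m m' => by ext; simp
      map_smul' := fun c m => by ext; simp }
    -- Balancedness over B holds because can⁻¹ is left A-linear: b can be moved out of can⁻¹(ba ⊗ h)
    -- and across into M.
    (fun m b a => by
      ext h
      have h1 : (b • a) ⊗ₜ[k] h = (b : A) ⊗ₜ 1 * a ⊗ₜ h := by simp [Subalgebra.smul_def]
      have h2 : indInclTensor k H A M (op b • m) = indInclTensor k H A M m ∘ₗ
          BTensor.rTensor A (coinvMulLeft k H A (b : A)) :=
        BTensor.hom_ext fun l r => by simp [BTensor.smul_tmul, Subalgebra.smul_def]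
      change indInclTensor k H A M (op b • m) (hA.canInv (a ⊗ₜ h)) =
        indInclTensor k H A M m (hA.canInv ((b • a) ⊗ₜ h))
      rw [h1, h2, hA.canInv_mul_left, LinearMap.comp_apply])

theorem IsHopfGalois.indCanInv_rTensor_indMk (hA : IsHopfGalois k H A) (m : M) (z : A ⊗[k] H) :
    hA.indCanInv M ((indMk k H A m).rTensor H z) = indInclTensor k H A M m (hA.canInv z) :=
  LinearMap.congr_fun (f := hA.indCanInv M ∘ₗ (indMk k H A m).rTensor H)
    (g := indInclTensor k H A M m ∘ₗ hA.canInv) (TensorProduct.ext' fun _ _ => rfl) z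

theorem IsHopfGalois.indCanInv_tmul_one (hA : IsHopfGalois k H A) (p : Ind k H A M) :
    hA.indCanInv M (p ⊗ₜ 1) = BTensor.tmul k _ p 1 := by
  induction p using BTensor.induction_on with
  | h0 => simp [BTensor.tmul]
  | ha x y hx hy => simp only [TensorProduct.add_tmul, map_add, BTensor.add_tmul, hx, hy]
  | ht m a =>
    change indInclTensor k H A M m (hA.canInv (a ⊗ₜ 1)) = _
    rw [hA.canInv_tmul_one, indInclTensor_tmul]

variable (k H A M) in
/-- The action map `(M ⊗_B A) ⊗_B A → M ⊗_B A`. -/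
def indAct : Ind k H A (Ind k H A M) →ₗ[k] Ind k H A M :=
  BTensor.lift (indRightAct k H A M).flip fun p b a => by
    rw [op_coinv_smul_ind, LinearMap.flip_apply, LinearMap.flip_apply, indRightAct_apply,
      indRightAct_apply, ← mul_smul, ← op_mul]
    rfl

@[simp]
theorem indAct_tmul (p : Ind k H A M) (a : A) :
    indAct k H A M (BTensor.tmul k _ p a) = op a • p := rfl

variable [IsScalarTower k (coinv k H A)ᵐᵒᵖ M] [IsScalarTower k (coinv k H A)ᵐᵒᵖ M']

/-- The right `A`-linear map `f ⊗_B A`. -/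
def indMap (f : M →ₗ[(coinv k H A)ᵐᵒᵖ] M') : Ind k H A M →ₗ[Aᵐᵒᵖ] Ind k H A M' where
  toFun := BTensor.rTensor A f
  map_add' := map_add _
  map_smul' a p := by
    induction p using BTensor.induction_on with
    | h0 => simp
    | ha x y hx hy => simp only [smul_add, map_add, hx, hy]
    | ht m c => rfl

theorem indMap_apply (f : M →ₗ[(coinv k H A)ᵐᵒᵖ] M') (p : Ind k H A M) :
    indMap f p = BTensor.rTensor A f p := rfl

@[simp]
theorem indMap_tmul (f : M →ₗ[(coinv k H A)ᵐᵒᵖ] M') (m : M) (a : A) :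
    indMap f (BTensor.tmul k _ m a) = BTensor.tmul k _ (f m) a := rfl

/-- can(1 ⊗ a) = ρ(a), so can⁻¹ turns the coaction into m ⊗ a ↦ (m ⊗ 1) ⊗ a. Coinvariance thereby
becomes a descent condition. -/
theorem IsHopfGalois.indCanInv_indCoact (hA : IsHopfGalois k H A) (p : Ind k H A M) :
    hA.indCanInv M (indCoact k H A M p) = indMap (indUnit k H A M) p := by
  induction p using BTensor.induction_on with
  | h0 => simp
  | ha x y hx hy => simp only [map_add, hx, hy]
  | ht m a => rw [indCoact_tmul, hA.indCanInv_rTensor_indMk, hA.canInv_coact]; rfl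

variable (k H A M) in
/-- The map `m ⊗_B a ↦ (m ⊗_B a) ⊗_B 1 - (m ⊗_B 1) ⊗_B a`. -/
def descentMap : Ind k H A M →ₗ[(coinv k H A)ᵐᵒᵖ] Ind k H A (Ind k H A M) :=
  indUnit k H A (Ind k H A M) -
    { toFun := indMap (indUnit k H A M)
      map_add' := map_add _
      map_smul' := fun b p => by
        obtain ⟨b, rfl⟩ := op_surjective b
        rw [op_coinv_smul_ind, map_smul, RingHom.id_apply, op_coinv_smul_ind] }

theorem descentMap_apply (p : Ind k H A M) :
    descentMap k H A M p = BTensor.tmul k _ p 1 - indMap (indUnit k H A M) p := rfl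

/-- A contracting homotopy: an element killed by `descentMap` ⊗_B A equals the image under `indUnit`
⊗_B A of its own product. -/
theorem indAct_rTensor_descentMap (x : Ind k H A (Ind k H A M)) :
    indAct k H A (Ind k H A M) (BTensor.rTensor A (descentMap k H A M) x) =
      x - BTensor.rTensor A (indUnit k H A M) (indAct k H A M x) := by
  induction x using BTensor.induction_on with
  | h0 => simp
  | ha x y hx hy => simp only [map_add, hx, hy]; abel
  | ht p a =>
    rw [BTensor.rTensor_tmul, indAct_tmul, indAct_tmul, descentMap_apply, smul_sub,
      op_smul_tmul_one, ← map_smul, indMap_apply]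

/-- The action map splits `indUnit` after tensoring with A. -/
theorem indAct_rTensor_indUnit (x : Ind k H A M) :
    indAct k H A M (BTensor.rTensor A (indUnit k H A M) x) = x := by
  induction x using BTensor.induction_on with
  | h0 => simp
  | ha x y hx hy => simp only [map_add, hx, hy]
  | ht m a => rw [BTensor.rTensor_tmul, indAct_tmul, indUnit_apply, op_smul_tmul_one]

end Descent

/-! ### Coinvariants of M ⊗_B A by faithfully flat descent -/

section FaithfullyFlat

variable {k : Type*} [CommRing k] {H : Type*} [Ring H] [HopfAlgebra k H]
variable {A : Type uA} [Ring A] [Algebra k A] [RightComoduleAlgebra k H A]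
variable {M : Type uM} [AddCommGroup M] [Module k M] [Module (coinv k H A)ᵐᵒᵖ M]
variable [IsScalarTower k (coinv k H A)ᵐᵒᵖ M]

theorem BTensor.rTensor_rTensor {k : Type*} [CommRing k] {B : Type*} [Ring B] [Algebra k B]
    {X : Type*} [AddCommGroup X] [Module k X] [Module Bᵐᵒᵖ X] [IsScalarTower k Bᵐᵒᵖ X]
    {X' : Type*} [AddCommGroup X'] [Module k X'] [Module Bᵐᵒᵖ X'] [IsScalarTower k Bᵐᵒᵖ X']
    {Y : Type*} [AddCommGroup Y] [Module k Y] [Module Bᵐᵒᵖ Y] [IsScalarTower k Bᵐᵒᵖ Y]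
    {N : Type*} [AddCommGroup N] [Module k N] [Module B N]
    (g : X' →ₗ[Bᵐᵒᵖ] Y) (f : X →ₗ[Bᵐᵒᵖ] X') (x : BTensor k B X N) :
    BTensor.rTensor N g (BTensor.rTensor N f x) = BTensor.rTensor (k := k) N (g ∘ₗ f) x :=
  LinearMap.congr_fun (f := BTensor.rTensor N g ∘ₗ BTensor.rTensor N f)
    (g := BTensor.rTensor N (g ∘ₗ f))
    (BTensor.hom_ext fun _ _ => rfl) x

theorem BTensor.rTensor_id {k : Type*} [CommRing k] {B : Type*} [Ring B] [Algebra k B]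
    {X : Type*} [AddCommGroup X] [Module k X] [Module Bᵐᵒᵖ X] [IsScalarTower k Bᵐᵒᵖ X]
    {N : Type*} [AddCommGroup N] [Module k N] [Module B N] (x : BTensor k B X N) :
    BTensor.rTensor (k := k) N (LinearMap.id : X →ₗ[Bᵐᵒᵖ] X) x = x :=
  LinearMap.congr_fun (f := BTensor.rTensor N LinearMap.id) (g := LinearMap.id)
    (BTensor.hom_ext fun _ _ => rfl) x

theorem BTensor.rTensor_zero {k : Type*} [CommRing k] {B : Type*} [Ring B] [Algebra k B]
    {X : Type*} [AddCommGroup X] [Module k X] [Module Bᵐᵒᵖ X] [IsScalarTower k Bᵐᵒᵖ X]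
    {X' : Type*} [AddCommGroup X'] [Module k X'] [Module Bᵐᵒᵖ X'] [IsScalarTower k Bᵐᵒᵖ X']
    {N : Type*} [AddCommGroup N] [Module k N] [Module B N] (x : BTensor k B X N) :
    BTensor.rTensor (k := k) N (0 : X →ₗ[Bᵐᵒᵖ] X') x = 0 :=
  LinearMap.congr_fun (f := BTensor.rTensor N (0 : X →ₗ[Bᵐᵒᵖ] X')) (g := 0)
    (BTensor.hom_ext fun _ n => BTensor.zero_tmul n) x

theorem indUnit_injective (hflat : LeftFaithfullyFlat.{max uA uM} k (coinv k H A) A) :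
    Function.Injective (indUnit k H A M) := by
  -- Flatness is stated for three modules in one universe, and M ⊗_B A lives in `max uA uM`, so M is
  -- lifted there. The sequence used is M → M → M ⊗_B A with first map zero.
  let e : ULift.{uA} M ≃ₗ[(coinv k H A)ᵐᵒᵖ] M := ULift.moduleEquiv
  have h := (hflat (ULift.{uA} M) (ULift.{uA} M) (Ind k H A M) 0
    (indUnit k H A M ∘ₗ e.toLinearMap)).1 fun y => by
      constructor
      · intro hy
        refine ⟨0, ?_⟩
        rw [map_zero]
        rw [← BTensor.rTensor_rTensor] at hy
        have h1 := congrArg (indAct k H A M) hy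
        rw [indAct_rTensor_indUnit, map_zero] at h1
        have h2 := congrArg (BTensor.rTensor A e.symm.toLinearMap) h1
        rw [BTensor.rTensor_rTensor, map_zero] at h2
        rw [← h2, ← BTensor.rTensor_id y, BTensor.rTensor_rTensor]
        congr 1
      · rintro ⟨y, rfl⟩
        rw [BTensor.rTensor_zero, map_zero]
  rw [injective_iff_map_eq_zero]
  intro m hm
  obtain ⟨y, hy⟩ := (h (e.symm m)).1 (by simpa using hm)
  simpa using hy.symm

/-- The sequence M → M ⊗_B A → M ⊗_B A ⊗_B A is exact after tensoring with A, by the homotopy, and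
faithful flatness reflects exactness. -/
theorem mem_range_indUnit (hA : IsHopfGalois k H A)
    (hflat : LeftFaithfullyFlat.{max uA uM} k (coinv k H A) A) {p : Ind k H A M}
    (hp : indCoact k H A M p = p ⊗ₜ 1) :
    p ∈ LinearMap.range (indUnit k H A M) := by
  let e : ULift.{uA} M ≃ₗ[(coinv k H A)ᵐᵒᵖ] M := ULift.moduleEquiv
  have h := (hflat (ULift.{uA} M) (Ind k H A M) (Ind k H A (Ind k H A M))
    (indUnit k H A M ∘ₗ e.toLinearMap) (descentMap k H A M)).1 fun x => by
      constructor
      · intro hx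
        have h1 := indAct_rTensor_descentMap x
        rw [hx, map_zero] at h1
        refine ⟨BTensor.rTensor A e.symm.toLinearMap (indAct k H A M x), ?_⟩
        rw [BTensor.rTensor_rTensor, LinearMap.comp_assoc, LinearEquiv.comp_symm, LinearMap.comp_id]
        exact (sub_eq_zero.1 h1.symm).symm
      · rintro ⟨y, rfl⟩
        have h1 : descentMap k H A M ∘ₗ (indUnit k H A M ∘ₗ e.toLinearMap) = 0 := by
          ext m
          simp [descentMap_apply]
        rw [BTensor.rTensor_rTensor, h1, BTensor.rTensor_zero]
  -- The Galois property enters here: the map induced by can⁻¹ sends p ⊗ 1 and ρ(p) to the two terms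
  -- of `descentMap`.
  have h0 : descentMap k H A M p = 0 := by
    rw [descentMap_apply, ← hA.indCanInv_tmul_one, ← hp, hA.indCanInv_indCoact, sub_self]
  obtain ⟨y, hy⟩ := (h p).1 h0
  exact ⟨e y, hy⟩

end FaithfullyFlat

/-! ### From module structures to colinear algebra maps -/

section OmegaOfLam

variable {k : Type*} [CommRing k] {H : Type*} [Ring H] [HopfAlgebra k H]
variable {A : Type*} [Ring A] [Algebra k A] [RightComoduleAlgebra k H A]
variable {M : Type*} [AddCommGroup M] [Module k M] [Module (coinv k H A)ᵐᵒᵖ M]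

namespace IsHopfGalois

theorem can_injective (hA : IsHopfGalois k H A) : Function.Injective (can k H A) := hA.1

variable (hA : IsHopfGalois k H A)

/-- Under `can` this says that ρ(b) = b ⊗ 1 commutes with 1 ⊗ h. -/
theorem op_smul_gamma (b : coinv k H A) (h : H) :
    op (b : A) • hA.gamma h = BTensor.rTensor A (coinvMulLeft k H A b) (hA.gamma h) := by
  apply hA.can_injective
  rw [can_op_smul, can_rTensor_coinvMulLeft, hA.can_gamma, coact_coinv]
  simp

theorem gamma_one : hA.gamma 1 = BTensor.tmul k _ 1 1 := hA.canInv_tmul_one 1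

/-- The map `l ⊗_B r ↦ ∑ l lᵢ(h) ⊗_B rᵢ(h) r`. -/
def gammaInsert (h : H) : BTensor k (coinv k H A) A A →ₗ[k] BTensor k (coinv k H A) A A :=
  hA.canInv ∘ₗ LinearMap.mulLeft k (1 ⊗ₜ h) ∘ₗ can k H A

/-- Under `can`, insertion is left multiplication by 1 ⊗ g. This is the source of multiplicativity
of t. -/
theorem gammaInsert_gamma (g h : H) : hA.gammaInsert g (hA.gamma h) = hA.gamma (g * h) := by
  apply hA.can_injective
  simp [gammaInsert]

theorem gammaInsert_tmul (h : H) (l r : A) :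
    hA.gammaInsert h (BTensor.tmul k _ l r) =
      BTensor.rTensor A (coinvMulLeft k H A l) (op r • hA.gamma h) := by
  apply hA.can_injective
  rw [can_rTensor_coinvMulLeft, can_op_smul, hA.can_gamma]
  simp [gammaInsert, can_tmul, ← mul_assoc]

/-- Colinearity of `can`, for the coaction on the right factor of A ⊗_B A and id ⊗ Δ on A ⊗ H; it is
coassociativity of ρ. -/
theorem rTensor_can_indCoact (x : BTensor k (coinv k H A) A A) :
    (can k H A).rTensor H (indCoact k H A A x) =
      (TensorProduct.assoc k A H H).symm
        ((Coalgebra.comul (R := k) (A := H)).lTensor A (can k H A x)) := by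
  induction x using BTensor.induction_on with
  | h0 => simp
  | ha x y hx hy => simp only [map_add, hx, hy]
  | ht l r =>
    rw [indCoact_tmul, can_tmul, ← LinearMap.comp_apply, ← LinearMap.rTensor_comp]
    have h1 : can k H A ∘ₗ indMk k H A l =
        LinearMap.mulLeft k (l ⊗ₜ 1) ∘ₗ (coact k H A).toLinearMap := rfl
    rw [h1, LinearMap.rTensor_comp, LinearMap.comp_apply]
    have h2 : (coact k H A).toLinearMap.rTensor H (coact k H A r) =
        (TensorProduct.assoc k A H H).symm
          ((Coalgebra.comul (R := k) (A := H)).lTensor A (coact k H A r)) := by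
      rw [← RightComoduleAlgebra.coact_coassoc, LinearEquiv.symm_apply_apply]
    rw [h2]
    induction coact k H A r with
    | zero => simp
    | add x y hx hy => simp only [map_add, mul_add, hx, hy]
    | tmul a h =>
      simp only [LinearMap.lTensor_tmul, Algebra.TensorProduct.tmul_mul_tmul, one_mul]
      induction Coalgebra.comul (R := k) h with
      | zero => simp
      | add x y hx hy => simp only [map_add, TensorProduct.tmul_add, hx, hy]
      | tmul g g' => simp

theorem indCoact_gamma (h : H) :
    indCoact k H A A (hA.gamma h) = hA.gamma.rTensor H (Coalgebra.comul h) := by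
  have hinj : Function.Injective ((can k H A).rTensor H) :=
    (LinearEquiv.rTensor H (LinearEquiv.ofBijective (can k H A) hA)).injective
  apply hinj
  rw [rTensor_can_indCoact, hA.can_gamma, ← LinearMap.comp_apply, ← LinearMap.rTensor_comp,
    LinearMap.lTensor_tmul]
  induction Coalgebra.comul (R := k) h with
  | zero => simp
  | add x y hx hy => simp only [map_add, TensorProduct.tmul_add, hx, hy]
  | tmul g g' => simp

/-- `∑ lᵢ(S⁻¹(a₁)) ⊗_B rᵢ(S⁻¹(a₁)) a₀ = a ⊗_B 1`. -/
theorem indRightAct_gamma_antipodeInv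
    (hS : Function.Bijective (HopfAlgebra.antipode k : H →ₗ[k] H)) (a : A) :
    TensorProduct.lift ((indRightAct k H A A).compl₂ (hA.gamma ∘ₗ antipodeInv hS))
      (coact k H A a) = BTensor.tmul k _ a 1 := by
  apply hA.can_injective
  -- Under `can` the left side is ∑ (1 ⊗ S⁻¹(a₁)) ρ(a₀) = ∑ a₀ ⊗ S⁻¹(a₂) a₁ = a ⊗ 1; `X` is a ⊗ g ⊗
  -- h ↦ a ⊗ S⁻¹(h) g.
  let X : A ⊗[k] (H ⊗[k] H) →ₗ[k] A ⊗[k] H :=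
    (LinearMap.mul' k H ∘ₗ TensorProduct.map (antipodeInv hS) LinearMap.id ∘ₗ
      (TensorProduct.comm k H H).toLinearMap).lTensor A
  have h1 : ∀ z, can k H A (TensorProduct.lift ((indRightAct k H A A).compl₂
      (hA.gamma ∘ₗ antipodeInv hS)) z) =
      X (TensorProduct.assoc k A H H ((coact k H A).toLinearMap.rTensor H z)) := by
    intro z
    induction z with
    | zero => simp
    | add x y hx hy => simp only [map_add, hx, hy]
    | tmul c h =>
      simp only [TensorProduct.lift.tmul, LinearMap.compl₂_apply, LinearMap.comp_apply,
        indRightAct_apply, can_op_smul, can_gamma, LinearMap.rTensor_tmul,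
        AlgHom.toLinearMap_apply]
      induction coact k H A c with
      | zero => simp
      | add x y hx hy => simp only [map_add, TensorProduct.add_tmul, mul_add, hx, hy]
      | tmul d g => simp [X]
  rw [h1, RightComoduleAlgebra.coact_coassoc, ← LinearMap.comp_apply, ← LinearMap.lTensor_comp,
    can_tmul, map_one, mul_one]
  have h2 : (LinearMap.mul' k H ∘ₗ TensorProduct.map (antipodeInv hS) LinearMap.id ∘ₗ
      (TensorProduct.comm k H H).toLinearMap) ∘ₗ Coalgebra.comul =
      Algebra.linearMap k H ∘ₗ Coalgebra.counit :=
    LinearMap.ext fun h => antipodeInv_mul_comul hS h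
  have h3 : ∀ z, (Algebra.linearMap k H).lTensor A z = TensorProduct.rid k A z ⊗ₜ 1 := fun z =>
    LinearMap.congr_fun (f := (Algebra.linearMap k H).lTensor A)
      (g := (TensorProduct.mk k A H).flip 1 ∘ₗ (TensorProduct.rid k A).toLinearMap)
      (by ext; simp) z
  rw [h2, LinearMap.lTensor_comp, LinearMap.comp_apply, h3, RightComoduleAlgebra.coact_counit]

end IsHopfGalois

variable [IsScalarTower k (coinv k H A)ᵐᵒᵖ M]

/-- Separates the dependence on m, a and x, so that linearity in each is inherited from known linear
maps. -/
theorem sweep_eq (φ : Ind k H A M →ₗ[(coinv k H A)ᵐᵒᵖ] M) (m : M) (a : A)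
    (x : BTensor k (coinv k H A) A A) :
    sweep φ m a x = op a • indMap φ (indInclTensor k H A M m x) := by
  induction x using BTensor.induction_on with
  | h0 => simp
  | ha x y hx hy => simp only [map_add, smul_add, hx, hy]
  | ht l r => rfl

theorem sweep_rTensor_coinvMulLeft (φ : Ind k H A M →ₗ[(coinv k H A)ᵐᵒᵖ] M) (m : M) (a : A)
    (b : coinv k H A) (x : BTensor k (coinv k H A) A A) :
    sweep φ m a (BTensor.rTensor A (coinvMulLeft k H A b) x) = sweep φ (op b • m) a x := by
  induction x using BTensor.induction_on with
  | h0 => simp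
  | ha x y hx hy => simp only [map_add, hx, hy]
  | ht l r =>
    rw [BTensor.rTensor_tmul, sweep_tmul, sweep_tmul, BTensor.smul_tmul]
    rfl

theorem sweep_op_smul (φ : Ind k H A M →ₗ[(coinv k H A)ᵐᵒᵖ] M) (m : M) (a c : A)
    (x : BTensor k (coinv k H A) A A) :
    sweep φ m a (op c • x) = sweep φ m (c * a) x := by
  induction x using BTensor.induction_on with
  | h0 => simp
  | ha x y hx hy => simp only [map_add, smul_add, hx, hy]
  | ht l r => rw [BTensor.op_smul_tmul, sweep_tmul, sweep_tmul, op_smul_eq_mul, mul_assoc]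

/-- The endomorphism `m ⊗_B a ↦ ∑ φ(m ⊗_B lᵢ(h)) ⊗_B rᵢ(h) a` of `M ⊗_B A`. -/
def sweepEnd (hA : IsHopfGalois k H A) (φ : Ind k H A M →ₗ[(coinv k H A)ᵐᵒᵖ] M) (h : H) :
    IndEnd k H A M where
  toFun := BTensor.lift
    (LinearMap.mk₂ k (fun m a => sweep φ m a (hA.gamma h))
      (fun m m' a => by simp only [sweep_eq, map_add, LinearMap.add_apply, smul_add])
      (fun c m a => by
        simp only [sweep_eq, map_smul, LinearMap.smul_apply]
        rw [LinearMap.map_smul_of_tower, smul_comm])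
      (fun m a a' => by simp only [sweep_eq, op_add, add_smul])
      (fun c m a => by simp only [sweep_eq, op_smul, smul_assoc]))
    -- Balancedness over B holds because γ(h) commutes with B.
    (fun m b a => by
      change sweep φ (op b • m) a (hA.gamma h) = sweep φ m ((b : A) * a) (hA.gamma h)
      rw [← sweep_rTensor_coinvMulLeft, ← hA.op_smul_gamma, sweep_op_smul])
  map_add' := map_add _
  map_smul' c p := by
    induction p using BTensor.induction_on with
    | h0 => simp
    | ha x y hx hy => simp only [smul_add, map_add, hx, hy]
    | ht m a =>
      change sweep φ m (a * c.unop) (hA.gamma h) = c • sweep φ m a (hA.gamma h)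
      rw [sweep_eq, sweep_eq, op_mul, op_unop, mul_smul]

theorem sweepEnd_tmul (hA : IsHopfGalois k H A) (φ : Ind k H A M →ₗ[(coinv k H A)ᵐᵒᵖ] M) (h : H)
    (m : M) (a : A) :
    sweepEnd hA φ h (BTensor.tmul k _ m a) = sweep φ m a (hA.gamma h) := rfl

/-- The map `h ↦ sweepEnd hA φ h` is `k`-linear. -/
def sweepEndLinear (hA : IsHopfGalois k H A) (φ : Ind k H A M →ₗ[(coinv k H A)ᵐᵒᵖ] M) :
    H →ₗ[k] IndEnd k H A M where
  toFun := sweepEnd hA φ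
  map_add' g h := indEnd_ext fun m => by
    rw [LinearMap.add_apply, sweepEnd_tmul, sweepEnd_tmul, sweepEnd_tmul, map_add, map_add]
  map_smul' c h := indEnd_ext fun m => by
    rw [RingHom.id_apply, LinearMap.smul_apply, sweepEnd_tmul, sweepEnd_tmul, map_smul, map_smul]

/-- Associativity of the action merges φ(φ(m ⊗ l) ⊗ l') into φ(m ⊗ l l'). A general x is needed
because γ(h) has no chosen expression as a sum of tensors. -/
theorem sweepEnd_sweep (hA : IsHopfGalois k H A) {φ : Ind k H A M →ₗ[(coinv k H A)ᵐᵒᵖ] M}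
    (hφ : φ ∈ Lam k H A M) (h : H) (m : M) (a : A) (x : BTensor k (coinv k H A) A A) :
    sweepEnd hA φ h (sweep φ m a x) = sweep φ m a (hA.gammaInsert h x) := by
  induction x using BTensor.induction_on with
  | h0 => simp
  | ha x y hx hy => simp only [map_add, hx, hy]
  | ht l r =>
    rw [sweep_tmul, sweepEnd_tmul, hA.gammaInsert_tmul]
    induction hA.gamma h using BTensor.induction_on with
    | h0 => simp
    | ha x y hx hy => simp only [map_add, smul_add, hx, hy]
    | ht l' r' =>
      rw [BTensor.op_smul_tmul, BTensor.rTensor_tmul, sweep_tmul, sweep_tmul, hφ.2,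
        coinvMulLeft_apply, op_smul_eq_mul, mul_assoc]

theorem sweepEnd_mul (hA : IsHopfGalois k H A) {φ : Ind k H A M →ₗ[(coinv k H A)ᵐᵒᵖ] M}
    (hφ : φ ∈ Lam k H A M) (g h : H) :
    sweepEnd hA φ (g * h) = sweepEnd hA φ g * sweepEnd hA φ h :=
  indEnd_ext fun m => by
    rw [Module.End.mul_apply, sweepEnd_tmul, sweepEnd_tmul, sweepEnd_sweep hA hφ,
      hA.gammaInsert_gamma]

theorem sweepEnd_one (hA : IsHopfGalois k H A) {φ : Ind k H A M →ₗ[(coinv k H A)ᵐᵒᵖ] M}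
    (hφ : φ ∈ Lam k H A M) : sweepEnd hA φ 1 = 1 :=
  indEnd_ext fun m => by
    rw [sweepEnd_tmul, hA.gamma_one, sweep_tmul, hφ.1, mul_one, Module.End.one_apply]

theorem indCoact_rTensor {M' : Type*} [AddCommGroup M'] [Module k M']
    [Module (coinv k H A)ᵐᵒᵖ M'] [IsScalarTower k (coinv k H A)ᵐᵒᵖ M']
    (f : M →ₗ[(coinv k H A)ᵐᵒᵖ] M') (p : Ind k H A M) :
    indCoact k H A M' (BTensor.rTensor A f p) =
      (BTensor.rTensor A f).rTensor H (indCoact k H A M p) := by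
  induction p using BTensor.induction_on with
  | h0 => simp
  | ha x y hx hy => simp only [map_add, hx, hy]
  | ht m a =>
    rw [BTensor.rTensor_tmul, indCoact_tmul, indCoact_tmul, ← LinearMap.comp_apply,
      ← LinearMap.rTensor_comp]
    rfl

/-- For a = 1 the sweep is f ⊗_B A with f(l) = φ(m ⊗ l), and such maps are colinear. -/
theorem indCoact_sweep_one (φ : Ind k H A M →ₗ[(coinv k H A)ᵐᵒᵖ] M) (m : M)
    (x : BTensor k (coinv k H A) A A) :
    indCoact k H A M (sweep φ m 1 x) = (sweep φ m 1).rTensor H (indCoact k H A A x) := by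
  have h1 : sweep φ m 1 = BTensor.rTensor A φ ∘ₗ BTensor.rTensor A (indIncl k H A m) :=
    LinearMap.ext fun x => by rw [sweep_eq, op_one, one_smul]; rfl
  rw [h1, LinearMap.comp_apply, indCoact_rTensor, indCoact_rTensor, LinearMap.rTensor_comp,
    LinearMap.comp_apply]

/-- Inherited from colinearity of γ; it yields at once that the endomorphism is rational and that t
is colinear. -/
theorem isCoactionOf_sweepEnd (hA : IsHopfGalois k H A)
    (φ : Ind k H A M →ₗ[(coinv k H A)ᵐᵒᵖ] M) (h : H) :
    IsCoactionOf (sweepEnd hA φ h) ((sweepEndLinear hA φ).rTensor H (Coalgebra.comul h)) :=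
  isCoactionOf_of_tmul_one fun m => by
    rw [sweepEnd_tmul, indCoact_sweep_one, hA.indCoact_gamma]
    induction Coalgebra.comul (R := k) h with
    | zero => simp
    | add x y hx hy => simp only [map_add, LinearMap.add_apply, hx, hy]
    | tmul g g' =>
      simp only [LinearMap.rTensor_tmul, endTensorAct_tmul, mul_one]
      rfl

/-- The algebra map `H → END_A(M ⊗_B A)` defined by `φ ∈ Λ_M`. -/
def sweepAlgHom (hA : IsHopfGalois k H A) (φ : Lam k H A M) : H →ₐ[k] RatEnd k H A M :=
  AlgHom.ofLinearMap
    ((sweepEndLinear hA φ.1).codRestrict (Subalgebra.toSubmodule (RatEnd k H A M)) fun h =>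
      ⟨_, isCoactionOf_sweepEnd hA φ.1 h⟩)
    (Subtype.ext (sweepEnd_one hA φ.2)) fun g h => Subtype.ext (sweepEnd_mul hA φ.2 g h)

/-- The element of `Ω_E` defined by `φ ∈ Λ_M`. -/
def omegaOfLam (hA : IsHopfGalois k H A) (φ : Lam k H A M) : Omega k H A M :=
  ⟨sweepAlgHom hA φ, isCoactionOf_sweepEnd hA φ.1⟩

theorem omegaOfLam_tmul (hA : IsHopfGalois k H A) (φ : Lam k H A M) (h : H) (m : M) (a : A) :
    ((omegaOfLam hA φ).1 h : IndEnd k H A M) (BTensor.tmul k _ m a) =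
      sweep φ.1 m a (hA.gamma h) := rfl

end OmegaOfLam

/-! ### The projection onto coinvariants defined by t -/

section LamOfOmega

variable {k : Type*} [CommRing k] {H : Type*} [Ring H] [HopfAlgebra k H]
variable {A : Type*} [Ring A] [Algebra k A] [RightComoduleAlgebra k H A]
variable {M : Type*} [AddCommGroup M] [Module k M] [Module (coinv k H A)ᵐᵒᵖ M]

/-- The map `p ⊗ h ↦ τ(h)(p)` for a linear map `τ : H → End_A(M ⊗_B A)`. -/
def endEval (τ : H →ₗ[k] IndEnd k H A M) : Ind k H A M ⊗[k] H →ₗ[k] Ind k H A M :=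
  TensorProduct.lift <| LinearMap.mk₂ k (fun p h => τ h p)
    (fun p p' h => map_add (τ h) p p')
    (fun c p h => LinearMap.map_smul_of_tower (τ h) c p)
    (fun p h h' => by rw [map_add, LinearMap.add_apply])
    (fun c p h => by rw [map_smul, LinearMap.smul_apply])

@[simp]
theorem endEval_tmul (τ : H →ₗ[k] IndEnd k H A M) (p : Ind k H A M) (h : H) :
    endEval τ (p ⊗ₜ h) = τ h p := rfl

/-- The algebra map `H → End_A(M ⊗_B A)` underlying an element of `Ω_E`. -/
def omegaHom (t : Omega k H A M) : H →ₐ[k] IndEnd k H A M := (RatEnd k H A M).val.comp t.1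

theorem omegaHom_apply (t : Omega k H A M) (h : H) :
    omegaHom t h = (t.1 h : IndEnd k H A M) := rfl

variable (hS : Function.Bijective (HopfAlgebra.antipode k : H →ₗ[k] H))

/-- The map `p ⊗ h ↦ t(S⁻¹(h))(p)`. -/
def twistEval (t : Omega k H A M) : Ind k H A M ⊗[k] H →ₗ[k] Ind k H A M :=
  endEval ((omegaHom t).toLinearMap ∘ₗ antipodeInv hS)

@[simp]
theorem twistEval_tmul (t : Omega k H A M) (p : Ind k H A M) (h : H) :
    twistEval hS t (p ⊗ₜ h) = omegaHom t (antipodeInv hS h) p := rfl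

/-- The map `p ↦ ∑ t(S⁻¹(p₁))(p₀)`. -/
def twist (t : Omega k H A M) : Ind k H A M →ₗ[k] Ind k H A M :=
  twistEval hS t ∘ₗ indCoact k H A M

theorem twist_apply (t : Omega k H A M) (p : Ind k H A M) :
    twist hS t p = twistEval hS t (indCoact k H A M p) := rfl

theorem twist_tmul_one (t : Omega k H A M) (m : M) :
    twist hS t (BTensor.tmul k _ m 1) = BTensor.tmul k _ m 1 := by
  rw [twist_apply, indCoact_tmul_one, twistEval_tmul, antipodeInv_one, map_one,
    Module.End.one_apply]

/-- t(S⁻¹(gh)) = t(S⁻¹(h)) t(S⁻¹(g)), and the inner factor passes through the A-action. Hence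
twist(pa) depends on p only through twist(p). -/
theorem twistEval_indTensorRightAct (t : Omega k H A M) (z : A ⊗[k] H)
    (q : Ind k H A M ⊗[k] H) :
    twistEval hS t (indTensorRightAct k H A M z q) =
      twistEval hS t (indTensorRightAct k H A M z (twistEval hS t q ⊗ₜ 1)) := by
  induction z with
  | zero => simp
  | add x y hx hy => simp only [map_add, LinearMap.add_apply, hx, hy]
  | tmul a h =>
    induction q with
    | zero => simp
    | add x y hx hy => simp only [map_add, TensorProduct.add_tmul, hx, hy]
    | tmul p g => simp [antipodeInv_mul]

theorem twist_op_smul (t : Omega k H A M) (a : A) (p : Ind k H A M) :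
    twist hS t (op a • p) =
      twistEval hS t (indTensorRightAct k H A M (coact k H A a) (twist hS t p ⊗ₜ 1)) := by
  rw [twist_apply, indCoact_op_smul, twistEval_indTensorRightAct, twist_apply]

theorem twist_op_coinv_smul (t : Omega k H A M) (b : coinv k H A) (p : Ind k H A M) :
    twist hS t (op b • p) = op b • twist hS t p := by
  rw [op_coinv_smul_ind, op_coinv_smul_ind, twist_op_smul, coact_coinv, indTensorRightAct_tmul,
    twistEval_tmul, one_mul, antipodeInv_one, map_one, Module.End.one_apply]

/-- The values of `twist` are coinvariant. -/
theorem indCoact_twist (t : Omega k H A M) (p : Ind k H A M) :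
    indCoact k H A M (twist hS t p) = twist hS t p ⊗ₜ 1 := by
  let ev : Ind k H A M ⊗[k] (H ⊗[k] H) →ₗ[k] Ind k H A M ⊗[k] H :=
    (endEval (omegaHom t).toLinearMap).rTensor H ∘ₗ (TensorProduct.assoc k _ H H).symm.toLinearMap
  have h1 : ∀ (y : H ⊗[k] H) (p : Ind k H A M) (g : H),
      endTensorAct k H A M ((omegaHom t).toLinearMap.rTensor H y) (p ⊗ₜ g) =
        ev (p ⊗ₜ (y * 1 ⊗ₜ g)) := by
    intro y p g
    induction y with
    | zero => simp
    | add x y hx hy =>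
      simp only [map_add, LinearMap.add_apply, add_mul, TensorProduct.tmul_add, hx, hy]
    | tmul h h' => simp [ev]
  -- Colinearity of t rewrites ρ(twist(p)) as `ev` of ∑ p₀ ⊗ Δ(S⁻¹(p₂))(1 ⊗ p₁), which collapses to
  -- ∑ p₀ ⊗ S⁻¹(p₁) ⊗ 1.
  have h2 : ∀ q, indCoact k H A M (twistEval hS t q) =
      ev ((comulAntipodeInvMul hS).lTensor _
        (TensorProduct.assoc k _ H H ((indCoact k H A M).rTensor H q))) := by
    intro q
    induction q with
    | zero => simp
    | add x y hx hy => simp only [map_add, hx, hy]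
    | tmul p h =>
      rw [twistEval_tmul, omegaHom_apply, t.2 (antipodeInv hS h) p, LinearMap.rTensor_tmul]
      induction indCoact k H A M p with
      | zero => simp
      | add x y hx hy => simp only [map_add, TensorProduct.add_tmul, hx, hy]
      | tmul p g => exact h1 _ _ _
  have h3 : ∀ q : Ind k H A M ⊗[k] H,
      ev ((comulAntipodeInvMul hS).lTensor _ (Coalgebra.comul.lTensor _ q)) =
        twistEval hS t q ⊗ₜ 1 := by
    intro q
    induction q with
    | zero => simp
    | add x y hx hy => simp only [map_add, TensorProduct.add_tmul, hx, hy]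
    | tmul p h =>
      rw [LinearMap.lTensor_tmul, LinearMap.lTensor_tmul, comulAntipodeInvMul_comul]
      simp [ev]
  rw [twist_apply, h2, indCoact_coassoc, h3]

/-- `∑ t(p₁)(twist(p₀)) = p`. -/
theorem endEval_rTensor_twist (t : Omega k H A M) (p : Ind k H A M) :
    endEval (omegaHom t).toLinearMap ((twist hS t).rTensor H (indCoact k H A M p)) = p := by
  -- The sum is ∑ t(p₂) t(S⁻¹(p₁))(p₀) = ∑ t(p₂ S⁻¹(p₁))(p₀); `μ` is g ⊗ h ↦ h S⁻¹(g).
  let μ : H ⊗[k] H →ₗ[k] H := LinearMap.mul' k H ∘ₗ TensorProduct.map LinearMap.id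
    (antipodeInv hS) ∘ₗ (TensorProduct.comm k H H).toLinearMap
  have h1 : ∀ q, endEval (omegaHom t).toLinearMap ((twist hS t).rTensor H q) =
      endEval (omegaHom t).toLinearMap (μ.lTensor _
        (TensorProduct.assoc k _ H H ((indCoact k H A M).rTensor H q))) := by
    intro q
    induction q with
    | zero => simp
    | add x y hx hy => simp only [map_add, hx, hy]
    | tmul p h =>
      rw [LinearMap.rTensor_tmul, LinearMap.rTensor_tmul, twist_apply]
      induction indCoact k H A M p with
      | zero => simp
      | add x y hx hy => simp only [map_add, TensorProduct.add_tmul, hx, hy]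
      | tmul p g => simp [μ]
  have h2 : μ ∘ₗ Coalgebra.comul = Algebra.linearMap k H ∘ₗ Coalgebra.counit :=
    LinearMap.ext fun h => mul_antipodeInv_comul hS h
  have h3 : ∀ q : Ind k H A M ⊗[k] k, endEval (omegaHom t).toLinearMap
      ((Algebra.linearMap k H).lTensor _ q) = TensorProduct.rid k _ q := by
    intro q
    induction q with
    | zero => simp
    | add x y hx hy => simp only [map_add, hx, hy]
    | tmul p c => simp
  rw [h1, indCoact_coassoc, ← LinearMap.comp_apply (μ.lTensor _), ← LinearMap.lTensor_comp, h2,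
    LinearMap.lTensor_comp, LinearMap.comp_apply, h3, indCoact_counit]

/-- `twist` as a right `B`-linear map. -/
def twistLinear (t : Omega k H A M) : Ind k H A M →ₗ[(coinv k H A)ᵐᵒᵖ] Ind k H A M where
  toFun := twist hS t
  map_add' := map_add _
  map_smul' b p := twist_op_coinv_smul hS t b.unop p

end LamOfOmega

/-! ### The bijection between Λ_M and Ω_E -/

section Correspondence

variable {k : Type*} [CommRing k] {H : Type*} [Ring H] [HopfAlgebra k H]
variable {A : Type uA} [Ring A] [Algebra k A] [RightComoduleAlgebra k H A]
variable {M : Type uM} [AddCommGroup M] [Module k M] [Module (coinv k H A)ᵐᵒᵖ M]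
variable [IsScalarTower k (coinv k H A)ᵐᵒᵖ M]
variable (hS : Function.Bijective (HopfAlgebra.antipode k : H →ₗ[k] H))
variable (hA : IsHopfGalois k H A)
variable (hflat : LeftFaithfullyFlat.{max uA uM} k (coinv k H A) A)

/-- The right `B`-linear map `φ : M ⊗_B A → M` with `φ(p) ⊗_B 1 = ∑ t(S⁻¹(p₁))(p₀)`. -/
def actionOfOmega (t : Omega k H A M) : Ind k H A M →ₗ[(coinv k H A)ᵐᵒᵖ] M :=
  (LinearEquiv.ofInjective (indUnit k H A M) (indUnit_injective hflat)).symm.toLinearMap ∘ₗ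
    (twistLinear hS t).codRestrict (LinearMap.range (indUnit k H A M)) fun p =>
      mem_range_indUnit hA hflat (indCoact_twist hS t p)

theorem tmul_actionOfOmega (t : Omega k H A M) (p : Ind k H A M) :
    BTensor.tmul k _ (actionOfOmega hS hA hflat t p) 1 = twist hS t p :=
  congrArg Subtype.val
    ((LinearEquiv.ofInjective (indUnit k H A M) (indUnit_injective hflat)).apply_symm_apply _)

/-- The two arguments are twist(p)a and pa, and `twist` fixes twist(p) because it lies in M ⊗ 1.
Associativity of the action follows. -/
theorem twist_tmul_actionOfOmega (t : Omega k H A M) (p : Ind k H A M) (a : A) :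
    twist hS t (BTensor.tmul k _ (actionOfOmega hS hA hflat t p) a) = twist hS t (op a • p) := by
  rw [← op_smul_tmul_one, twist_op_smul, twist_op_smul, twist_tmul_one, tmul_actionOfOmega]

theorem actionOfOmega_mem (t : Omega k H A M) : actionOfOmega hS hA hflat t ∈ Lam k H A M := by
  constructor
  · intro m
    apply indUnit_injective hflat
    rw [indUnit_apply, indUnit_apply, tmul_actionOfOmega, twist_tmul_one]
  · intro m a a'
    apply indUnit_injective hflat
    rw [indUnit_apply, indUnit_apply, tmul_actionOfOmega, tmul_actionOfOmega,
      twist_tmul_actionOfOmega, BTensor.op_smul_tmul, op_smul_eq_mul]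

/-- The element of `Λ_M` defined by `t ∈ Ω_E`. -/
def lamOfOmega (t : Omega k H A M) : Lam k H A M :=
  ⟨actionOfOmega hS hA hflat t, actionOfOmega_mem hS hA hflat t⟩

/-- Comes from ∑ t(p₁)(twist(p₀)) = p. At x = γ(h) the right side is t(h)(twist(m ⊗ 1)) = t(h)(m ⊗
1), which recovers t. -/
theorem sweep_actionOfOmega (t : Omega k H A M) (m : M) (x : BTensor k (coinv k H A) A A) :
    sweep (actionOfOmega hS hA hflat t) m 1 x =
      endEval (omegaHom t).toLinearMap ((twist hS t).rTensor H
        ((indMk k H A m).rTensor H (can k H A x))) := by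
  induction x using BTensor.induction_on with
  | h0 => simp
  | ha x y hx hy => simp only [map_add, hx, hy]
  | ht a a' =>
    have h1 := endEval_rTensor_twist hS t (BTensor.tmul k _
      (actionOfOmega hS hA hflat t (BTensor.tmul k _ m a)) a')
    rw [sweep_tmul, mul_one, ← h1, indCoact_tmul, can_tmul]
    congr 1
    induction coact k H A a' with
    | zero => simp
    | add x y hx hy => simp only [map_add, mul_add, hx, hy]
    | tmul c h =>
      simp only [LinearMap.rTensor_tmul, indMk_apply, Algebra.TensorProduct.tmul_mul_tmul, one_mul,
        twist_tmul_actionOfOmega, BTensor.op_smul_tmul, op_smul_eq_mul]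

theorem omegaOfLam_lamOfOmega (t : Omega k H A M) :
    omegaOfLam hA (lamOfOmega hS hA hflat t) = t := by
  refine Subtype.ext (AlgHom.ext fun h => Subtype.ext (indEnd_ext fun m => ?_))
  rw [omegaOfLam_tmul]
  refine (sweep_actionOfOmega hS hA hflat t m _).trans ?_
  rw [hA.can_gamma, LinearMap.rTensor_tmul, LinearMap.rTensor_tmul, indMk_apply, twist_tmul_one]
  rfl

/-- The twist is the sweep of ∑ γ(S⁻¹(a₁)) a₀ = a ⊗ 1. -/
theorem twist_omegaOfLam (φ : Lam k H A M) (m : M) (a : A) :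
    twist hS (omegaOfLam hA φ) (BTensor.tmul k _ m a) =
      BTensor.tmul k _ (φ.1 (BTensor.tmul k _ m a)) 1 := by
  have h1 : ∀ z, twistEval hS (omegaOfLam hA φ) ((indMk k H A m).rTensor H z) =
      sweep φ.1 m 1 (TensorProduct.lift
        ((indRightAct k H A A).compl₂ (hA.gamma ∘ₗ antipodeInv hS)) z) := by
    intro z
    induction z with
    | zero => simp
    | add x y hx hy => simp only [map_add, hx, hy]
    | tmul c h =>
      rw [LinearMap.rTensor_tmul, indMk_apply, twistEval_tmul, omegaHom_apply, omegaOfLam_tmul,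
        TensorProduct.lift.tmul, LinearMap.compl₂_apply, indRightAct_apply, sweep_op_smul, mul_one]
      rfl
  rw [twist_apply, indCoact_tmul, h1, hA.indRightAct_gamma_antipodeInv, sweep_tmul, mul_one]

theorem lamOfOmega_omegaOfLam (φ : Lam k H A M) :
    lamOfOmega hS hA hflat (omegaOfLam hA φ) = φ := by
  refine Subtype.ext (LinearMap.ext fun p => ?_)
  induction p using BTensor.induction_on with
  | h0 => simp
  | ha x y hx hy => simp only [map_add, hx, hy]
  | ht m a =>
    apply indUnit_injective hflat
    rw [indUnit_apply, indUnit_apply, ← twist_omegaOfLam hS hA φ]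
    exact tmul_actionOfOmega hS hA hflat _ _

/-- The bijection between `Λ_M` and `Ω_E`. -/
def lamEquivOmega : Lam k H A M ≃ Omega k H A M where
  toFun := omegaOfLam hA
  invFun := lamOfOmega hS hA hflat
  left_inv := lamOfOmega_omegaOfLam hS hA hflat
  right_inv := omegaOfLam_lamOfOmega hS hA hflat

end Correspondence

/-! ### Comparison of the equivalence relations -/

section Equivalence

variable {k : Type*} [CommRing k] {H : Type*} [Ring H] [HopfAlgebra k H]
variable {A : Type uA} [Ring A] [Algebra k A] [RightComoduleAlgebra k H A]
variable {M : Type uM} [AddCommGroup M] [Module k M] [Module (coinv k H A)ᵐᵒᵖ M]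
-- Stated for arbitrary modules so that two A-module structures on the same M can be supplied
-- explicitly.
theorem nonempty_linearEquiv_iff {R X Y : Type*} [Semiring R] [AddCommMonoid X] [AddCommMonoid Y]
    [Module R X] [Module R Y] :
    Nonempty (X ≃ₗ[R] Y) ↔ ∃ f : X ≃+ Y, ∀ (r : R) (x : X), f (r • x) = r • f x :=
  ⟨fun ⟨e⟩ => ⟨e.toAddEquiv, e.map_smul⟩, fun ⟨f, hf⟩ => ⟨f.toLinearEquiv hf⟩⟩

/-- An A-linear isomorphism is automatically B-linear, since φ(m ⊗ b) = m b for both structures. -/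
theorem lam_equiv_iff (φ₁ φ₂ : Lam k H A M) : φ₁ ≈ φ₂ ↔
    ∃ f : M ≃ₗ[(coinv k H A)ᵐᵒᵖ] M, ∀ (m : M) (a : A),
      f (φ₁.1 (BTensor.tmul k _ m a)) = φ₂.1 (BTensor.tmul k _ (f m) a) := by
  have hφ : ∀ (φ : Lam k H A M) (b : coinv k H A) (m : M),
      φ.1 (BTensor.tmul k _ m (b : A)) = op b • m := fun φ => (Lam.toModuleExt φ).2
  refine (@nonempty_linearEquiv_iff Aᵐᵒᵖ M M _ _ _ (Lam.toModuleExt φ₁).1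
    (Lam.toModuleExt φ₂).1).trans ⟨?_, ?_⟩
  · rintro ⟨f, hf⟩
    have hf' : ∀ (m : M) (a : A),
        f (φ₁.1 (BTensor.tmul k _ m a)) = φ₂.1 (BTensor.tmul k _ (f m) a) :=
      fun m a => hf (op a) m
    refine ⟨f.toLinearEquiv fun b m => ?_, hf'⟩
    obtain ⟨b, rfl⟩ := op_surjective b
    rw [← hφ φ₁, hf', hφ]
  · rintro ⟨f, hf⟩
    exact ⟨f.toAddEquiv, fun a m => hf m a.unop⟩

variable [IsScalarTower k (coinv k H A)ᵐᵒᵖ M]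

theorem isCoactionOf_indMap (f : M →ₗ[(coinv k H A)ᵐᵒᵖ] M) :
    IsCoactionOf (indMap f : IndEnd k H A M) ((indMap f : IndEnd k H A M) ⊗ₜ[k] (1 : H)) :=
  isCoactionOf_of_tmul_one fun m => by
    rw [endTensorAct_tmul, indMap_tmul, indCoact_tmul_one, mul_one]

/-- The coinvariant endomorphism `f ⊗_B A` for a right `B`-linear endomorphism `f` of `M`. -/
def coinvOfEnd (f : M →ₗ[(coinv k H A)ᵐᵒᵖ] M) : ratEndCoinv k H A M :=
  ⟨⟨indMap f, _, isCoactionOf_indMap f⟩, isCoactionOf_indMap f⟩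

theorem coinvOfEnd_apply (f : M →ₗ[(coinv k H A)ᵐᵒᵖ] M) :
    ((coinvOfEnd f : ratEndCoinv k H A M).1 : IndEnd k H A M) = indMap f := rfl

theorem coinvOfEnd_comp (f g : M →ₗ[(coinv k H A)ᵐᵒᵖ] M) :
    coinvOfEnd f * coinvOfEnd g = (coinvOfEnd (f ∘ₗ g) : ratEndCoinv k H A M) :=
  Subtype.ext (Subtype.ext (indEnd_ext fun _ => rfl))

theorem coinvOfEnd_id : coinvOfEnd LinearMap.id = (1 : ratEndCoinv k H A M) :=
  Subtype.ext (Subtype.ext (indEnd_ext fun _ => rfl))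

/-- The unit `f ⊗_B A` of `E^{co H}` for a right `B`-linear automorphism `f` of `M`. -/
def coinvUnit (f : M ≃ₗ[(coinv k H A)ᵐᵒᵖ] M) : (ratEndCoinv k H A M)ˣ where
  val := coinvOfEnd f.toLinearMap
  inv := coinvOfEnd f.symm.toLinearMap
  val_inv := by rw [coinvOfEnd_comp, LinearEquiv.comp_symm, coinvOfEnd_id]
  inv_val := by rw [coinvOfEnd_comp, LinearEquiv.symm_comp, coinvOfEnd_id]

/-- Every coinvariant of `E` is of the form `f ⊗_B A`. -/
theorem coinvOfEnd_surjective (hA : IsHopfGalois k H A)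
    (hflat : LeftFaithfullyFlat.{max uA uM} k (coinv k H A) A) :
    Function.Surjective (coinvOfEnd : _ → ratEndCoinv k H A M) := by
  intro w
  let v : IndEnd k H A M := w.1
  let g : M →ₗ[(coinv k H A)ᵐᵒᵖ] Ind k H A M :=
    { toFun := fun m => v (indUnit k H A M m)
      map_add' := fun m m' => by rw [map_add, map_add]
      map_smul' := fun b m => by
        obtain ⟨b, rfl⟩ := op_surjective b
        rw [map_smul, op_coinv_smul_ind, map_smul, RingHom.id_apply, op_coinv_smul_ind] }
  -- A coinvariant endomorphism maps the coinvariant m ⊗ 1 to a coinvariant, hence into M ⊗ 1.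
  have hg : ∀ m, g m ∈ LinearMap.range (indUnit k H A M) := fun m => by
    apply mem_range_indUnit hA hflat
    have h1 := w.2 (BTensor.tmul k _ m 1)
    rwa [indCoact_tmul_one, endTensorAct_tmul, mul_one] at h1
  refine ⟨(LinearEquiv.ofInjective (indUnit k H A M) (indUnit_injective hflat)).symm.toLinearMap ∘ₗ
    g.codRestrict _ hg, Subtype.ext (Subtype.ext (indEnd_ext fun m => ?_))⟩
  rw [coinvOfEnd_apply, indMap_tmul]
  exact congrArg Subtype.val ((LinearEquiv.ofInjective (indUnit k H A M)
    (indUnit_injective hflat)).apply_symm_apply (g.codRestrict _ hg m))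

theorem coinvOfEnd_injective
    (hflat : LeftFaithfullyFlat.{max uA uM} k (coinv k H A) A) :
    Function.Injective (coinvOfEnd : _ → ratEndCoinv k H A M) := by
  intro f g h
  ext m
  apply indUnit_injective hflat
  exact LinearMap.congr_fun (congrArg (fun w => (w.1 : IndEnd k H A M)) h)
    (BTensor.tmul k _ m 1)

theorem coinvUnit_surjective (hA : IsHopfGalois k H A)
    (hflat : LeftFaithfullyFlat.{max uA uM} k (coinv k H A) A) :
    Function.Surjective (coinvUnit : _ → (ratEndCoinv k H A M)ˣ) := by
  intro u
  obtain ⟨f, hf⟩ := coinvOfEnd_surjective hA hflat u.val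
  obtain ⟨g, hg⟩ := coinvOfEnd_surjective hA hflat u.inv
  refine ⟨LinearEquiv.ofLinearMap f g ?_ ?_, Units.ext hf⟩ <;> apply coinvOfEnd_injective hflat
  · rw [← coinvOfEnd_comp, hf, hg, u.val_inv, coinvOfEnd_id]
  · rw [← coinvOfEnd_comp, hf, hg, u.inv_val, coinvOfEnd_id]

/-- f ↦ f ⊗_B A carries the automorphisms of M onto the units of E^{co H}. -/
theorem omega_equiv_iff (hA : IsHopfGalois k H A)
    (hflat : LeftFaithfullyFlat.{max uA uM} k (coinv k H A) A)
    (t₁ t₂ : Omega k H A M) : t₁ ≈ t₂ ↔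
    ∃ f : M ≃ₗ[(coinv k H A)ᵐᵒᵖ] M, ∀ (h : H) (x : Ind k H A M),
      BTensor.rTensor (k := k) A f.toLinearMap ((t₁.1 h : IndEnd k H A M) x) =
        (t₂.1 h : IndEnd k H A M) (BTensor.rTensor (k := k) A f.toLinearMap x) := by
  change (∃ u : (ratEndCoinv k H A M)ˣ, _) ↔ _
  rw [(coinvUnit_surjective hA hflat).exists]
  refine exists_congr fun f => forall_congr' fun h => ⟨fun e x => ?_, fun e => ?_⟩
  · exact LinearMap.congr_fun (congrArg Subtype.val e) x
  · exact Subtype.ext (LinearMap.ext e)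

theorem rTensor_sweep {φ₁ φ₂ : Ind k H A M →ₗ[(coinv k H A)ᵐᵒᵖ] M}
    {f : M →ₗ[(coinv k H A)ᵐᵒᵖ] M}
    (hf : ∀ (m : M) (a : A), f (φ₁ (BTensor.tmul k _ m a)) = φ₂ (BTensor.tmul k _ (f m) a))
    (m : M) (a : A) (x : BTensor k (coinv k H A) A A) :
    BTensor.rTensor A f (sweep φ₁ m a x) = sweep φ₂ (f m) a x := by
  induction x using BTensor.induction_on with
  | h0 => simp
  | ha x y hx hy => simp only [map_add, hx, hy]
  | ht l r => rw [sweep_tmul, sweep_tmul, BTensor.rTensor_tmul, hf]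

theorem rTensor_twistEval (hS : Function.Bijective (HopfAlgebra.antipode k : H →ₗ[k] H))
    {t₁ t₂ : Omega k H A M} {f : M →ₗ[(coinv k H A)ᵐᵒᵖ] M}
    (hf : ∀ (h : H) (x : Ind k H A M),
      BTensor.rTensor (k := k) A f ((t₁.1 h : IndEnd k H A M) x) =
        (t₂.1 h : IndEnd k H A M) (BTensor.rTensor (k := k) A f x))
    (p : Ind k H A M) :
    BTensor.rTensor A f (twist hS t₁ p) = twist hS t₂ (BTensor.rTensor A f p) := by
  rw [twist_apply, twist_apply, indCoact_rTensor]
  induction indCoact k H A M p with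
  | zero => simp
  | add x y hx hy => simp only [map_add, hx, hy]
  | tmul p h => exact hf _ p

/-- The same f serves on both sides: f ⊗_B A commutes with sweeps when f intertwines the actions,
and with twists when it intertwines t₁ and t₂. -/
theorem lam_equiv_iff_omegaOfLam (hA : IsHopfGalois k H A)
    (hflat : LeftFaithfullyFlat.{max uA uM} k (coinv k H A) A)
    (hS : Function.Bijective (HopfAlgebra.antipode k : H →ₗ[k] H)) (φ₁ φ₂ : Lam k H A M) :
    φ₁ ≈ φ₂ ↔ omegaOfLam hA φ₁ ≈ omegaOfLam hA φ₂ := by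
  rw [lam_equiv_iff, omega_equiv_iff hA hflat]
  refine exists_congr fun f => ⟨fun hf h x => ?_, fun hf m a => ?_⟩
  · induction x using BTensor.induction_on with
    | h0 => simp
    | ha x y hx hy => simp only [map_add, hx, hy]
    | ht m a =>
      rw [BTensor.rTensor_tmul, omegaOfLam_tmul, omegaOfLam_tmul]
      exact rTensor_sweep hf m a _
  · have h1 := rTensor_twistEval hS hf (BTensor.tmul k _ m a)
    rw [BTensor.rTensor_tmul, twist_omegaOfLam, twist_omegaOfLam, BTensor.rTensor_tmul] at h1
    exact indUnit_injective hflat h1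

/-- Every right `A`-module structure on `M` extending the `B`-action comes from `Λ_M`. -/
theorem toModuleExt_surjective :
    Function.Surjective (Lam.toModuleExt : Lam k H A M → ModuleExt k H A M) := by
  rintro ⟨s, hs⟩
  let _ := s
  have hs' : ∀ (b : coinv k H A) (m : M), op (b : A) • m = op b • m := hs
  -- The scalars of k lie in B, so the new A-action is compatible with the given k-structure.
  have hk : ∀ (c : k) (m : M), op (algebraMap k A c) • m = c • m := fun c m =>
    (hs' (algebraMap k _ c) m).trans (algebraMap_smul (coinv k H A)ᵐᵒᵖ c m)
  let φ : Ind k H A M →ₗ[k] M := BTensor.lift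
    (LinearMap.mk₂ k (fun m a => op a • m)
      (fun m m' a => smul_add _ _ _)
      (fun c m a => by
        rw [← hk, ← hk, ← mul_smul, ← mul_smul, ← op_mul, ← op_mul, Algebra.commutes])
      (fun m a a' => by rw [op_add, add_smul])
      (fun c m a => by
        rw [Algebra.smul_def, Algebra.commutes, op_mul, mul_smul, hk]))
    (fun m b a => by
      rw [LinearMap.mk₂_apply, LinearMap.mk₂_apply, ← hs', ← mul_smul, ← op_mul]
      rfl)
  have hφ : ∀ m a, φ (BTensor.tmul k _ m a) = op a • m := fun _ _ => rfl
  let ψ : Ind k H A M →ₗ[(coinv k H A)ᵐᵒᵖ] M :=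
    { toFun := φ
      map_add' := map_add φ
      map_smul' := fun b p => by
        obtain ⟨b, rfl⟩ := op_surjective b
        rw [RingHom.id_apply]
        induction p using BTensor.induction_on with
        | h0 => simp
        | ha x y hx hy => simp only [smul_add, map_add, hx, hy]
        | ht m a =>
          rw [BTensor.op_smul_tmul, hφ, hφ, ← hs', ← mul_smul, ← op_mul]
          rfl }
  have hψ : ∀ m a, ψ (BTensor.tmul k _ m a) = op a • m := fun _ _ => rfl
  refine ⟨⟨ψ, fun m => ?_, fun m a a' => ?_⟩, Subtype.ext (Module.ext rfl)⟩
  · rw [hψ, op_one, one_smul]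
  · rw [hψ, hψ, hψ, op_mul, mul_smul]

end Equivalence
end HopfGalois

end
open HopfGalois in
theorem proposition6p5
    {k : Type uk} [CommRing k]
    {H : Type uH} [Ring H] [HopfAlgebra k H] [Module.Projective k H]
    (hS : Function.Bijective (HopfAlgebra.antipode k : H →ₗ[k] H))
    {A : Type uA} [Ring A] [Algebra k A] [RightComoduleAlgebra k H A]
    (hA : IsHopfGalois k H A)
    (hflat : LeftFaithfullyFlat.{max uA uM} k (coinv k H A) A)
    {M : Type uM} [AddCommGroup M] [Module k M] [Module (coinv k H A)ᵐᵒᵖ M]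
    [IsScalarTower k (coinv k H A)ᵐᵒᵖ M] :
    ∃ α : Lam k H A M ≃ Omega k H A M,
      -- `α(φ) = t` is given by `t(h)(m ⊗ a) = ∑ φ(m ⊗ lᵢ(h)) ⊗ rᵢ(h) a`
      (∀ (φ : Lam k H A M) (h : H) (m : M) (a : A),
        ((α φ).1 h : IndEnd k H A M) (BTensor.tmul k _ m a) = sweep φ.1 m a (hA.gamma h)) ∧
      -- `φ₁ ∼ φ₂` if and only if `t₁ ∼ t₂`
      (∀ φ₁ φ₂ : Lam k H A M, φ₁ ≈ φ₂ ↔ α φ₁ ≈ α φ₂) ∧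
      -- `t₁ ∼ t₂` if and only if they are conjugate by a unit `f` of `End_B(M)`
      (∀ t₁ t₂ : Omega k H A M, t₁ ≈ t₂ ↔
        ∃ f : M ≃ₗ[(coinv k H A)ᵐᵒᵖ] M, ∀ (h : H) (x : Ind k H A M),
          BTensor.rTensor (k := k) A f.toLinearMap ((t₁.1 h : IndEnd k H A M) x) =
            (t₂.1 h : IndEnd k H A M) (BTensor.rTensor (k := k) A f.toLinearMap x)) ∧
      -- `α` induces a bijection from `Λ_M / ∼` to `Ω_E / ∼`
      (∃ β : Quotient (Lam.setoid k H A M) ≃ Quotient (Omega.setoid k H A M),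
        ∀ φ : Lam k H A M, β ⟦φ⟧ = ⟦α φ⟧) ∧
      -- `Ω_E / ∼` classifies the right `A`-module structures on `M` extending the `B`-action
      (∃ δ : Quotient (Omega.setoid k H A M) ≃ Quotient (ModuleExt.setoid k H A M),
        ∀ φ : Lam k H A M, δ ⟦α φ⟧ = ⟦Lam.toModuleExt φ⟧) := by
  let β : Quotient (Lam.setoid k H A M) ≃ Quotient (Omega.setoid k H A M) :=
    Quotient.congr (lamEquivOmega hS hA hflat) (lam_equiv_iff_omegaOfLam hA hflat hS)
  -- The relation on Λ_M is pulled back along `Lam.toModuleExt`, so injectivity is formal and only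
  -- surjectivity has content.
  let ε : Quotient (Lam.setoid k H A M) ≃ Quotient (ModuleExt.setoid k H A M) :=
    Equiv.ofBijective (Quotient.map Lam.toModuleExt fun _ _ h => h) <| by
      constructor
      · intro x y
        induction x using Quotient.inductionOn
        induction y using Quotient.inductionOn
        intro h
        have h' : Lam.toModuleExt _ ≈ Lam.toModuleExt _ := Quotient.exact h
        exact Quotient.sound h'
      · intro y
        induction y using Quotient.inductionOn with
        | h s =>
          obtain ⟨φ, rfl⟩ := toModuleExt_surjective s
          exact ⟨⟦φ⟧, rfl⟩
  exact ⟨lamEquivOmega hS hA hflat, omegaOfLam_tmul hA, lam_equiv_iff_omegaOfLam hA hflat hS,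
    omega_equiv_iff hA hflat, ⟨β, fun _ => rfl⟩, β.symm.trans ε, fun φ =>
      congrArg ε (β.symm_apply_apply ⟦φ⟧)⟩
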